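/- \textbf{Setting.} Let $\mathbf{C}$ be a category and $\mathcal{M}$ a class of monomorphisms of $\mathbf{C}$. The pair is an \emph{$\mathcal{M}$-adhesive category} if $\mathcal{M}$ contains all isomorphisms, is closed under composition and decomposition ($g\circ f\in\mathcal{M}$, $g\in\mathcal{M}$ imply $f\in\mathcal{M}$), pushouts and pullbacks along $\mathcal{M}$-morphisms exist and preserve $\mathcal{M}$-morphisms, and every pushout along an $\mathcal{M}$-morphism is an $\mathcal{M}$-van Kampen square: in every commutative cube over it whose back faces are pullbacks and whose three vertical edges other than the rear one are in $\mathcal{M}$, the top face is a pushout if and only if the front faces are pullbacks. We assume that $\mathbf{C}$ is $\mathcal{M}$-adhesive and moreover: \begin{itemize} \item every morphism factors, uniquely up to isomorphism, as an epimorphism followed by an $\mathcal{M}$-morphism; $\mathbf{C}$ is balanced (every monic epimorphism is an isomorphism); \item $\mathbf{C}$ has a strict $\mathcal{M}$-initial object: an object with exactly one monomorphism to each object, which is in $\mathcal{M}$, and such that every morphism into it is an isomorphism; \item $\mathcal{M}$-effective unions: if $b:B\to E$ and $c:C\to E$ are in $\mathcal{M}$ and $D$ is the pushout of $B\leftarrow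 B\times_E C\to C$, then the induced morphism $D\to E$ is in $\mathcal{M}$; \item every object is finite, i.e.\ has only finitely many $\mathcal{M}$-subobjects. \end{itemize} \textbf{Conditions.} Conditions over an object $P$ are generated inductively by $\mathsf{true}$, by $\exists(a:P\to Q,\mathsf{c}_Q)$ with $a\in\mathcal{M}$ and $\mathsf{c}_Q$ a condition over $Q$, by negation, and by conjunctions over arbitrary index sets; $\mathsf{false}:=\neg\mathsf{true}$ and disjunctions are derived. An $\mathcal{M}$-morphism $p:P\to H$ satisfies $\exists(a,\mathsf{c}_Q)$, written $p\vDash\exists(a,\mathsf{c}_Q)$, if there is $q:Q\to H$ in $\mathcal{M}$ with $q\circ a=p$ and $q\vDash\mathsf{c}_Q$; the other cases are the usual ones. Write $\mathsf{c}\equiv\mathsf{c}'$ if the same $\mathcal{M}$-morphisms out of $P$ satisfy $\mathsf{c}$ and $\mathsf{c}'$. A \emph{linear rule} is a span $r=(O\leftarrow K\to I)$ of $\mathcal{M}$-morphisms. An \emph{admissible match} of $r$ into an object $X$ is an $\mathcal{M}$-morphism $m:I\to X$ such that $K\to I\to X$ has a pushout complement. A \emph{rule with application condition} is a pair $R=(r,\mathsf{c}_I)$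 of a linear rule and a condition over its input $I$. $\mathsf{Shift}$ and $\mathsf{Trans}$ commute with $\mathsf{true}$, negations and conjunctions. For $p:P\to Q$ in $\mathcal{M}$, $$\mathsf{Shift}(p,\exists(a:P\to A,\mathsf{c}))=\bigvee\exists(r:Q\to E,\mathsf{Shift}(s:A\to E,\mathsf{c})),$$ where the disjunction runs over all $\mathcal{M}$-morphisms $x:P\to X$, $p'':X\to Q$, $a'':X\to A$ with $p''x=p$, $a''x=a$, up to isomorphism, and $(E,r,s)$ is the pushout of $(p'',a'')$. For a linear rule $r=(O\leftarrow K\to I)$ and $a:O\to O'$ in $\mathcal{M}$: if $K\to O\to O'$ has a pushout complement $K\to K'\to O'$, let $I'$ with $a^*:I\to I'$ be the pushout of $K'\leftarrow K\to I$, and set $\mathsf{Trans}(r,\exists(a,\mathsf{c}))=\exists(a^*,\mathsf{Trans}(O'\leftarrow K'\to I',\mathsf{c}))$; otherwise $\mathsf{Trans}(r,\exists(a,\mathsf{c}))=\mathsf{false}$. \textbf{Composition.} Let $R_j=(O_j\leftarrow K_j\to I_j,\mathsf{c}_{I_j})$, $j=1,2$, and let $\mu_{21}=(I_2\leftarrow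 M_{21}\to O_1)$ be a span of $\mathcal{M}$-morphisms, with pushout $N_{21}$. Suppose that $K_2\to I_2\to N_{21}$ and $K_1\to O_1\to N_{21}$ have pushout complements $K_2'$ and $K_1'$. Let $O_{21}$ be the pushout of $O_2\leftarrow K_2\to K_2'$, $I_{21}$ the pushout of $K_1'\leftarrow K_1\to I_1$, $K_{21}=K_2'\times_{N_{21}}K_1'$, and $$\mathsf{c}_{I_{21}}=\mathsf{Shift}(I_1\to I_{21},\mathsf{c}_{I_1})\wedge\mathsf{Trans}\bigl(N_{21}\leftarrow K_1'\to I_{21},\ \mathsf{Shift}(I_2\to N_{21},\mathsf{c}_{I_2})\bigr).$$ If moreover $\mathsf{c}_{I_{21}}\not\equiv\mathsf{false}$, then $\mu_{21}$ is an \emph{admissible match} of $R_2$ into $R_1$, and the composite is $R_{21}=R_2\stackrel{\mu_{21}}{\triangleleft}R_1:=(O_{21}\leftarrow K_{21}\to I_{21},\mathsf{c}_{I_{21}})$, determined up to isomorphism. Let $\mathsf{M}_{R_2}(R_1)$ be the set of isomorphism classes of admissible matches. \textbf{Theorem (DPO-type associativity).} Let $R_1,R_2,R_3$ be three linear rules with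 application conditions. There is a bijection between $$M_A=\{(\mu_{21},\mu_{3(21)})\mid\mu_{21}\in\mathsf{M}_{R_2}(R_1),\ \mu_{3(21)}\in\mathsf{M}_{R_3}(R_{21})\}$$ and $$M_B=\{(\mu_{32},\mu_{(32)1})\mid\mu_{32}\in\mathsf{M}_{R_3}(R_2),\ \mu_{(32)1}\in\mathsf{M}_{R_{32}}(R_1)\}$$ such that for each pair of corresponding elements there is an isomorphism (of spans, with varying end points) between the linear rules of $R_3\stackrel{\mu_{3(21)}}{\triangleleft}(R_2\stackrel{\mu_{21}}{\triangleleft}R_1)$ and $(R_3\stackrel{\mu_{32}}{\triangleleft}R_2)\stackrel{\mu_{(32)1}}{\triangleleft}R_1$ along which their conditions are equivalent under admissibility: for every object $X$ and every admissible match $m:I_{3(21)}\to X$ of the first composite linear rule, $m\vDash\mathsf{c}_{I_{3(21)}}$ if and only if $m\circ\iota^{-1}\vDash\mathsf{c}_{I_{(32)1}}$, where $\iota:I_{3(21)}\to I_{(32)1}$ is the input component of the isomorphism. -/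

import Mathlib

open CategoryTheory CategoryTheory.Limits

universe v u

namespace DPORewriting

section Category

/-! ## `M`-adhesive categories -/

/-- `(C, M)` is an `M`-adhesive category, for a class `M` of monomorphisms. -/
class MAdhesive {C : Type u} [Category.{v} C] (M : MorphismProperty C) : Prop where
  mono_of_mem : ∀ ⦃A B : C⦄ (f : A ⟶ B), M f → Mono f
  mem_of_isIso : ∀ ⦃A B : C⦄ (f : A ⟶ B), IsIso f → M f
  comp_mem : ∀ ⦃A B D : C⦄ (f : A ⟶ B) (g : B ⟶ D), M f → M g → M (f ≫ g)
  decomp_mem : ∀ ⦃A B D : C⦄ (f : A ⟶ B) (g : B ⟶ D), M (f ≫ g) → M g → M f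
  hasPushout : ∀ ⦃A B D : C⦄ (m : A ⟶ B) (f : A ⟶ D), M m → HasPushout m f
  hasPullback : ∀ ⦃A B D : C⦄ (n : A ⟶ D) (g : B ⟶ D), M n → HasPullback n g
  pushout_mem : ∀ ⦃A B D E : C⦄ ⦃m : A ⟶ B⦄ ⦃f : A ⟶ D⦄ ⦃g : B ⟶ E⦄ ⦃n : D ⟶ E⦄,
    IsPushout m f g n → M m → M n
  pullback_mem : ∀ ⦃A B D E : C⦄ ⦃m : A ⟶ B⦄ ⦃f : A ⟶ D⦄ ⦃g : B ⟶ E⦄ ⦃n : D ⟶ E⦄,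
    IsPullback m f g n → M n → M m
  /-- Pushouts along `M`-morphisms are `M`-van Kampen squares. The bottom square of the cube is
  `m, f, g, n`, its top square is `m', f', g', n'`, and `a, b, c, d` are the vertical edges. -/
  vanKampen : ∀ ⦃A B D E : C⦄ ⦃m : A ⟶ B⦄ ⦃f : A ⟶ D⦄ ⦃g : B ⟶ E⦄ ⦃n : D ⟶ E⦄,
    IsPushout m f g n → M m →
    ∀ ⦃A' B' D' E' : C⦄ (m' : A' ⟶ B') (f' : A' ⟶ D') (g' : B' ⟶ E') (n' : D' ⟶ E')
      (a : A' ⟶ A) (b : B' ⟶ B) (c : D' ⟶ D) (d : E' ⟶ E),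
      IsPullback m' a b m → IsPullback f' a c f →
      CommSq g' b d g → CommSq n' c d n → CommSq m' f' g' n' →
      M b → M c → M d →
      (IsPushout m' f' g' n' ↔ (IsPullback g' b d g ∧ IsPullback n' c d n))

variable {C : Type u} [Category.{v} C]

/-- Every morphism factors as an epimorphism followed by an `M`-morphism, uniquely up to
isomorphism. -/
def HasEpiMFactorization (M : MorphismProperty C) : Prop :=
  (∀ ⦃A B : C⦄ (f : A ⟶ B), ∃ (F : C) (e : A ⟶ F) (m : F ⟶ B), Epi e ∧ M m ∧ e ≫ m = f) ∧
  ∀ ⦃A B F F' : C⦄ (e : A ⟶ F) (m : F ⟶ B) (e' : A ⟶ F') (m' : F' ⟶ B),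
    Epi e → M m → Epi e' → M m' → e ≫ m = e' ≫ m' →
      ∃ φ : F ≅ F', e ≫ φ.hom = e' ∧ φ.hom ≫ m' = m

/-- There is an object admitting exactly one monomorphism to each object, which is in `M`, and
such that every morphism into it is an isomorphism. -/
def HasStrictMInitial (M : MorphismProperty C) : Prop :=
  ∃ Z : C, (∀ A : C, ∃ i : Z ⟶ A, Mono i ∧ M i ∧ ∀ j : Z ⟶ A, Mono j → j = i) ∧
    ∀ (X : C) (f : X ⟶ Z), IsIso f

/-- `M`-effective unions: the morphism `d` that the pushout `D` of a pullback of two `M`-morphisms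
`b`, `c` into `E` induces is again in `M`. -/
def HasMEffectiveUnions (M : MorphismProperty C) : Prop :=
  ∀ ⦃A B D E X : C⦄ (b' : A ⟶ B) (c' : A ⟶ X) (e : B ⟶ D) (f : X ⟶ D) (b : B ⟶ E) (c : X ⟶ E)
    (d : D ⟶ E),
    M b' → M c' → M e → M f → M b → M c →
    IsPushout b' c' e f → IsPullback b' c' b c → e ≫ d = b → f ≫ d = c → M d

/-- Every object is finite, that is, has only finitely many `M`-subobjects. -/
def IsMFinitary (M : MorphismProperty C) : Prop :=
  ∀ A : C, Finite {S : Subobject A // M S.arrow}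

variable {M : MorphismProperty C}

/-- Pushouts along `M`-morphisms are pullbacks. -/
theorem MAdhesive.isPullback_of_isPushout [MAdhesive M] {A B D E : C} {m : A ⟶ B} {f : A ⟶ D}
    {g : B ⟶ E} {n : D ⟶ E} (h : IsPushout m f g n) (hm : M m) : IsPullback m f g n := by
  have : Mono m := MAdhesive.mono_of_mem m hm
  exact ((MAdhesive.vanKampen h hm (𝟙 _) f f (𝟙 D) (𝟙 _) m (𝟙 _) n
    (IsKernelPair.id_of_mono m) (IsPullback.of_vert_isIso ⟨by simp⟩) h.1.flip ⟨rfl⟩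
    ⟨by simp⟩ hm (MAdhesive.mem_of_isIso _ inferInstance) (MAdhesive.pushout_mem h hm)).mp
    (IsPushout.of_horiz_isIso ⟨by simp⟩)).1.flip

/-! ## Spans of `M`-morphisms, linear rules -/

/-- A span `A ← S → B` of `M`-morphisms. -/
structure MSpan (M : MorphismProperty C) (A B : C) where
  apex : C
  left : apex ⟶ A
  right : apex ⟶ B
  left_mem : M left
  right_mem : M right

/-- A linear rule `O ← K → I` from the input object `I` to the output object `O`;
`apex` is `K`. -/
abbrev LinearRule (M : MorphismProperty C) (O I : C) := MSpan M O I

/-- Isomorphism of spans over fixed end points. -/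
def MSpan.Equiv {A B : C} (s t : MSpan M A B) : Prop :=
  ∃ φ : s.apex ≅ t.apex, φ.hom ≫ t.left = s.left ∧ φ.hom ≫ t.right = s.right

theorem MSpan.equiv_equivalence (A B : C) :
    Equivalence (MSpan.Equiv : MSpan M A B → MSpan M A B → Prop) where
  refl s := ⟨Iso.refl _, by simp, by simp⟩
  symm := by
    rintro s t ⟨φ, h₁, h₂⟩
    exact ⟨φ.symm, by simp [← h₁], by simp [← h₂]⟩
  trans := by
    rintro s t w ⟨φ, h₁, h₂⟩ ⟨ψ, h₃, h₄⟩
    exact ⟨φ ≪≫ ψ, by simp [h₁, h₃], by simp [h₂, h₄]⟩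

/-- An isomorphism of linear rules, with varying input and output objects. -/
structure LinearRule.Iso {O I O' I' : C} (r : LinearRule M O I) (r' : LinearRule M O' I') where
  ω : O ≅ O'
  κ : r.apex ≅ r'.apex
  ι : I ≅ I'
  left_comm : κ.hom ≫ r'.left = r.left ≫ ω.hom
  right_comm : κ.hom ≫ r'.right = r.right ≫ ι.hom

/-- `m : I ⟶ X` is an admissible match of the plain rule `r` into `X`: it is in `M` and the
pushout complement of `K ⟶ I ⟶ X` exists. -/
def LinearRule.IsMatch {O I X : C} (r : LinearRule M O I) (m : I ⟶ X) : Prop :=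
  M m ∧ ∃ (L : C) (k : r.apex ⟶ L) (x : L ⟶ X), IsPushout r.right k m x

/-! ## Conditions -/

/-- (Nested application) conditions over an object. -/
inductive Condition (M : MorphismProperty C) : C → Type (max u v + 1)
  | true (P : C) : Condition M P
  | ex {P Q : C} (a : P ⟶ Q) (ha : M a) (c : Condition M Q) : Condition M P
  | neg {P : C} (c : Condition M P) : Condition M P
  | conj {P : C} (J : Type (max u v)) (c : J → Condition M P) : Condition M P

namespace Condition

/-- The condition `false`. -/
def false (P : C) : Condition M P := neg (true P)

/-- Disjunction of a family of conditions. -/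
def disj {P : C} (J : Type (max u v)) (c : J → Condition M P) : Condition M P :=
  neg (conj J fun j => neg (c j))

/-- Conjunction of two conditions. -/
def and {P : C} (c d : Condition M P) : Condition M P :=
  conj (ULift Bool) fun b => if b.down then c else d

/-- `c.Sat p`: the morphism `p` satisfies the condition `c`. It is used for `p` in `M` only. -/
def Sat : {P : C} → Condition M P → {H : C} → (P ⟶ H) → Prop
  | _, true _, _, _ => True
  | _, ex (Q := Q) a _ c, H, p => ∃ q : Q ⟶ H, M q ∧ a ≫ q = p ∧ c.Sat q
  | _, neg c, _, p => ¬ c.Sat p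
  | _, conj _ c, _, p => ∀ j, (c j).Sat p

/-- Equivalence of conditions over `P`. -/
def Equivalent {P : C} (c d : Condition M P) : Prop :=
  ∀ (H : C) (p : P ⟶ H), M p → (c.Sat p ↔ d.Sat p)

end Condition

/-! ## The shift construction -/

/-- The data over which the disjunction in the shift of `∃ (a : P ⟶ A, c)` along `p : P ⟶ Q`
runs: `M`-morphisms `x : P ⟶ X`, `p₂ : X ⟶ Q`, `a₂ : X ⟶ A` that factor `p` and `a`, and
a pushout `E` of `p₂` and `a₂` (whose legs `r` and `s` are then in `M`). Isomorphic data give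
equivalent disjuncts. -/
structure ShiftData (M : MorphismProperty C) {P Q A : C} (p : P ⟶ Q) (a : P ⟶ A) where
  X : C
  x : P ⟶ X
  p₂ : X ⟶ Q
  a₂ : X ⟶ A
  x_mem : M x
  p₂_mem : M p₂
  a₂_mem : M a₂
  fac_p : x ≫ p₂ = p
  fac_a : x ≫ a₂ = a
  E : C
  r : Q ⟶ E
  s : A ⟶ E
  isPushout : IsPushout p₂ a₂ r s

theorem ShiftData.r_mem [MAdhesive M] {P Q A : C} {p : P ⟶ Q} {a : P ⟶ A}
    (D : ShiftData M p a) : M D.r :=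
  MAdhesive.pushout_mem D.isPushout.flip D.a₂_mem

/-- `c.shift p` is the shift of the condition `c` along `p`. -/
def Condition.shift [MAdhesive M] :
    {P : C} → Condition M P → {Q : C} → (P ⟶ Q) → Condition M Q
  | _, .true _, Q, _ => .true Q
  | _, .ex a _ c, _, p => .disj (ShiftData M p a) fun D => .ex D.r D.r_mem (c.shift D.s)
  | _, .neg c, _, p => .neg (c.shift p)
  | _, .conj J c, _, p => .conj J fun j => (c j).shift p

/-! ## The transport construction -/

/-- The diagram of two pushout squares that transports `a : O ⟶ O'` over the rule
`O ← K → I`: a pushout complement of `K ⟶ O ⟶ O'`, and a pushout. -/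
structure TransDiagram {O I O' : C} (r : LinearRule M O I) (a : O ⟶ O') where
  K' : C
  k : r.apex ⟶ K'
  o' : K' ⟶ O'
  poc : IsPushout r.left k a o'
  I' : C
  a_star : I ⟶ I'
  i' : K' ⟶ I'
  po : IsPushout r.right k a_star i'

namespace TransDiagram

variable [MAdhesive M] {O I O' : C} {r : LinearRule M O I} {a : O ⟶ O'}

theorem a_star_mem (D : TransDiagram r a) (ha : M a) : M D.a_star :=
  MAdhesive.pushout_mem D.po.flip
    (MAdhesive.pullback_mem (MAdhesive.isPullback_of_isPushout D.poc r.left_mem).flip ha)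

/-- The transported rule `O' ← K' → I'`. -/
def rule (D : TransDiagram r a) : LinearRule M O' D.I' where
  apex := D.K'
  left := D.o'
  right := D.i'
  left_mem := MAdhesive.pushout_mem D.poc r.left_mem
  right_mem := MAdhesive.pushout_mem D.po r.right_mem

end TransDiagram

open Classical in
/-- `c.trans r` is the transport of the condition `c` over the output of the rule `r` to a
condition over the input of `r`. -/
noncomputable def Condition.trans [MAdhesive M] :
    {O : C} → Condition M O → {I : C} → LinearRule M O I → Condition M I
  | _, .true _, I, _ => .true I
  | _, .ex a ha c, I, r =>
      if h : Nonempty (TransDiagram r a) then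
        .ex h.some.a_star (h.some.a_star_mem ha) (c.trans h.some.rule)
      else .false I
  | _, .neg c, _, r => .neg (c.trans r)
  | _, .conj J c, _, r => .conj J fun j => (c j).trans r

/-! ## Rules with application conditions and their composition -/

/-- A linear rule `O ← K → I` with an application condition over its input `I`. -/
structure RuleAC (M : MorphismProperty C) where
  O : C
  I : C
  rule : LinearRule M O I
  cond : Condition M I

/-- The diagram that composes `R₂` with `R₁` along a span `μ = (I₂ ← M₂₁ → O₁)`. -/
structure CompDiagram (R₂ R₁ : RuleAC M) (μ : MSpan M R₂.I R₁.O) where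
  /-- the object `N₂₁`, pushout of the overlap -/
  N : C
  m₂' : R₂.I ⟶ N
  m₁' : R₁.O ⟶ N
  po_N : IsPushout μ.left μ.right m₂' m₁'
  /-- pushout complement of `K₂ ⟶ I₂ ⟶ N₂₁` -/
  K₂' : C
  k₂ : R₂.rule.apex ⟶ K₂'
  n₂ : K₂' ⟶ N
  poc₂ : IsPushout R₂.rule.right k₂ m₂' n₂
  /-- pushout complement of `K₁ ⟶ O₁ ⟶ N₂₁` -/
  K₁' : C
  k₁ : R₁.rule.apex ⟶ K₁'
  n₁ : K₁' ⟶ N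
  poc₁ : IsPushout R₁.rule.left k₁ m₁' n₁
  O₂₁ : C
  p₂ : R₂.O ⟶ O₂₁
  o₂' : K₂' ⟶ O₂₁
  po₂ : IsPushout R₂.rule.left k₂ p₂ o₂'
  I₂₁ : C
  p₁ : R₁.I ⟶ I₂₁
  i₁' : K₁' ⟶ I₂₁
  po₁ : IsPushout R₁.rule.right k₁ p₁ i₁'
  K₂₁ : C
  l₂ : K₂₁ ⟶ K₂'
  l₁ : K₂₁ ⟶ K₁'
  pb : IsPullback l₂ l₁ n₂ n₁

namespace CompDiagram

variable [MAdhesive M] {R₂ R₁ : RuleAC M} {μ : MSpan M R₂.I R₁.O}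

/-- The linear rule `N₂₁ ← K₁' → I₂₁`. -/
def lowerRule (D : CompDiagram R₂ R₁ μ) : LinearRule M D.N D.I₂₁ where
  apex := D.K₁'
  left := D.n₁
  right := D.i₁'
  left_mem := MAdhesive.pushout_mem D.poc₁ R₁.rule.left_mem
  right_mem := MAdhesive.pushout_mem D.po₁ R₁.rule.right_mem

/-- The composite rule `O₂₁ ← K₂₁ → I₂₁` with its composite application condition. -/
noncomputable def composite (D : CompDiagram R₂ R₁ μ) : RuleAC M where
  O := D.O₂₁
  I := D.I₂₁
  rule :=
    { apex := D.K₂₁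
      left := D.l₂ ≫ D.o₂'
      right := D.l₁ ≫ D.i₁'
      left_mem := MAdhesive.comp_mem _ _
        (MAdhesive.pullback_mem D.pb (MAdhesive.pushout_mem D.poc₁ R₁.rule.left_mem))
        (MAdhesive.pushout_mem D.po₂ R₂.rule.left_mem)
      right_mem := MAdhesive.comp_mem _ _
        (MAdhesive.pullback_mem D.pb.flip (MAdhesive.pushout_mem D.poc₂ R₂.rule.right_mem))
        (MAdhesive.pushout_mem D.po₁ R₁.rule.right_mem) }
  cond := (R₁.cond.shift D.p₁).and ((R₂.cond.shift D.m₂').trans D.lowerRule)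

end CompDiagram

variable [MAdhesive M]

/-- The span `μ` is an admissible match of `R₂` into `R₁`: the composition diagram is
constructible, and the composite application condition is not equivalent to `false`. -/
def IsAdmissible (R₂ R₁ : RuleAC M) (μ : MSpan M R₂.I R₁.O) : Prop :=
  ∃ D : CompDiagram R₂ R₁ μ, ¬ D.composite.cond.Equivalent (.false _)

/-- Isomorphism of admissible spans. -/
def admissibleSetoid (R₂ R₁ : RuleAC M) :
    Setoid {μ : MSpan M R₂.I R₁.O // IsAdmissible R₂ R₁ μ} :=
  Setoid.comap Subtype.val ⟨MSpan.Equiv, MSpan.equiv_equivalence R₂.I R₁.O⟩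

/-- The admissible matches of `R₂` into `R₁`: admissible spans `I₂ ← M₂₁ → O₁` up to
isomorphism. -/
def Match (R₂ R₁ : RuleAC M) := Quotient (admissibleSetoid R₂ R₁)

/-- The composite of `R₂` with `R₁` along an admissible match (determined up to isomorphism;
a representative is chosen). -/
noncomputable def comp (R₂ R₁ : RuleAC M) (μ : Match R₂ R₁) : RuleAC M :=
  (Quotient.out μ).2.choose.composite

/-- Equivalence under admissibility of the conditions of two rules whose plain rules are
isomorphic via `e`: every admissible match of the plain rule into any object satisfies the one
condition iff the corresponding match satisfies the other. -/
def DotEquivAlong {R R' : RuleAC M} (e : LinearRule.Iso R.rule R'.rule) : Prop :=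
  ∀ (X : C) (m : R.I ⟶ X), R.rule.IsMatch m → (R.cond.Sat m ↔ R'.cond.Sat (e.ι.inv ≫ m))

end Category

end DPORewriting

namespace DPORewriting

variable {C : Type u} [Category.{v} C] {M : MorphismProperty C} [MAdhesive M]

/-! ## Pushouts and pullbacks along `M`-morphisms -/

namespace MAdhesive

/-- Pushouts along `M`-morphisms are stable under pullback along `M`-morphisms. -/
theorem isPushout_of_isPullback {A B D E A' B' D' E' : C} {m : A ⟶ B} {f : A ⟶ D}
    {g : B ⟶ E} {n : D ⟶ E} (h : IsPushout m f g n) (hm : M m)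
    {m' : A' ⟶ B'} {f' : A' ⟶ D'} {g' : B' ⟶ E'} {n' : D' ⟶ E'}
    {a : A' ⟶ A} {b : B' ⟶ B} {c : D' ⟶ D} {d : E' ⟶ E} (hd : M d)
    (h₁ : IsPullback g' b d g) (h₂ : IsPullback n' c d n) (h₃ : IsPullback m' a b m)
    (hf : f' ≫ c = a ≫ f) (hw : m' ≫ g' = f' ≫ n') : IsPushout m' f' g' n' := by
  have h₄ : IsPullback f' a c f := by
    refine IsPullback.of_right (h₁₂ := n') (v₁₃ := d) (h₂₂ := n) ?_ hf h₂
    rw [← hw, ← h.w]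
    exact h₃.paste_horiz h₁
  exact (vanKampen h hm m' f' g' n' a b c d h₃ h₄ ⟨h₁.w⟩ ⟨h₂.w⟩ ⟨hw⟩
    (pullback_mem h₁.flip hd) (pullback_mem h₂.flip hd) hd).mpr ⟨h₁, h₂⟩

/-- A pushout complement of `A ⟶ B ⟶ E` maps to any pushout complement of
`A ⟶ B ⟶ E ⟶ E'`. -/
theorem exists_pushoutComplement_map {A B D E D' E' : C} {m : A ⟶ B} {f : A ⟶ D}
    {g : B ⟶ E} {n : D ⟶ E} {f' : A ⟶ D'} {g' : B ⟶ E'} {n' : D' ⟶ E'} {u : E ⟶ E'}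
    (h : IsPushout m f g n) (h' : IsPushout m f' g' n') (hm : M m) (hu : M u)
    (hg : g ≫ u = g') : ∃ w : D ⟶ D', f ≫ w = f' ∧ IsPushout n w u n' := by
  have := mono_of_mem u hu
  have := mono_of_mem m hm
  have hn : M n := pushout_mem h hm
  have hn' : M n' := pushout_mem h' hm
  have := mono_of_mem n' hn'
  have hd : M (n ≫ u) := comp_mem _ _ hn hu
  have := hasPullback n' (n ≫ u) hn'
  have hP := IsPullback.of_hasPullback n' (n ≫ u)
  have hc : M (pullback.fst n' (n ≫ u)) := pullback_mem hP hd
  have := mono_of_mem _ hc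
  have e : f' ≫ n' = f ≫ n ≫ u := by rw [← h'.w, ← hg, ← Category.assoc, h.w, Category.assoc]
  -- As `u` is monic, pulling `g'` back along `n ≫ u` amounts to pulling `g` back along `n`, which
  -- gives `A`.
  have hB : IsPullback f m (n ≫ u) g' := by
    rw [← hg]
    have h₀ := isPullback_of_isPushout h hm
    refine IsPullback.of_isLimit' ⟨by rw [← Category.assoc, ← h.w, Category.assoc]⟩
      (PullbackCone.IsLimit.mk _ (fun s => h₀.lift s.snd s.fst ?_) ?_ ?_ ?_)
    · have := s.condition
      simp only [← Category.assoc, cancel_mono] at this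
      exact this.symm
    · intro s; simp
    · intro s; simp
    · intro s t ht₁ ht₂
      apply h₀.hom_ext <;> simp [ht₁, ht₂]
  -- Pulling the pushout `h'` back along `D ⟶ E'` produces a pushout with an identity edge. The
  -- opposite edge, the projection from `D' ×_{E'} D` to `D`, is therefore invertible, so `D` lies
  -- below `D'` in `E'`.
  have hpo : IsPushout (𝟙 A) (hP.lift f' f e) f (pullback.snd n' (n ≫ u)) := by
    refine isPushout_of_isPullback h' hm hd hB hP.flip (IsKernelPair.id_of_mono m) ?_ ?_
    · simp
    · simp
  have : IsIso (pullback.snd n' (n ≫ u)) := hpo.isIso_inr_of_isIso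
  have hfw : f ≫ inv (pullback.snd n' (n ≫ u)) = hP.lift f' f e := by
    rw [IsIso.comp_inv_eq]; simp
  have hwn : inv (pullback.snd n' (n ≫ u)) ≫ pullback.fst n' (n ≫ u) ≫ n' = n ≫ u := by
    rw [IsIso.inv_comp_eq, pullback.condition]
  have hw : f ≫ inv (pullback.snd n' (n ≫ u)) ≫ pullback.fst n' (n ≫ u) = f' := by
    rw [← Category.assoc, hfw]; simp
  refine ⟨_, hw, ?_⟩
  refine IsPushout.of_top (v₁₁ := f) (v₁₂ := g) ?_ ?_ h
  · rw [hw, hg]; exact h'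
  · rw [Category.assoc, hwn]

/-- A pushout complement of `A ⟶ B ⟶ E ⟶ E'` restricts to one of `A ⟶ B ⟶ E`. -/
theorem exists_pushoutComplement_restrict {A B E D' E' : C} {m : A ⟶ B} {g : B ⟶ E}
    {f' : A ⟶ D'} {n' : D' ⟶ E'} {u : E ⟶ E'} (hm : M m) (hu : M u)
    (h' : IsPushout m f' (g ≫ u) n') :
    ∃ (D : C) (f : A ⟶ D) (n : D ⟶ E), IsPushout m f g n := by
  have := mono_of_mem u hu
  have := mono_of_mem m hm
  have := hasPullback u n' hu
  have hP := IsPullback.of_hasPullback u n'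
  -- The complement is `E ×_{E'} D'`: pull the given pushout back along `u`. Since `g ≫ u` factors
  -- through the monomorphism `u`, the corner `B` pulls back to itself.
  refine ⟨_, hP.lift (m ≫ g) f' (by simpa using h'.w), _,
    isPushout_of_isPullback (a := 𝟙 _) (b := 𝟙 _) h' hm hu ?_ hP ?_ (by simp) (by simp)⟩
  · refine IsPullback.of_isLimit' ⟨by simp⟩
      (PullbackCone.IsLimit.mk _ (fun s => s.snd) ?_ ?_ ?_)
    · intro s
      rw [← cancel_mono u]
      simpa using s.condition.symm
    · intro s; simp
    · intro s t _ ht₂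
      simpa using ht₂
  · exact IsPullback.of_vert_isIso ⟨by simp⟩

end MAdhesive

/-! ## The calculus of transport diagrams -/

/-- The span with its legs exchanged. -/
def MSpan.rev {A B : C} (s : MSpan M A B) : MSpan M B A where
  apex := s.apex
  left := s.right
  right := s.left
  left_mem := s.right_mem
  right_mem := s.left_mem

/-- The composite of two linear rules, given by a pullback. -/
def MSpan.comp {O N I K : C} (r₂ : LinearRule M O N) (r₁ : LinearRule M N I)
    {l₂ : K ⟶ r₂.apex} {l₁ : K ⟶ r₁.apex} (pb : IsPullback l₂ l₁ r₂.right r₁.left) :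
    LinearRule M O I where
  apex := K
  left := l₂ ≫ r₂.left
  right := l₁ ≫ r₁.right
  left_mem := MAdhesive.comp_mem _ _ (MAdhesive.pullback_mem pb r₁.left_mem) r₂.left_mem
  right_mem := MAdhesive.comp_mem _ _ (MAdhesive.pullback_mem pb.flip r₂.right_mem) r₁.right_mem

namespace TransDiagram

variable {O I O' O'' : C} {r : LinearRule M O I} {a : O ⟶ O'}

/-- The transport diagram read from input to output. -/
def rev (D : TransDiagram r a) : TransDiagram r.rev D.a_star where
  K' := D.K'
  k := D.k
  o' := D.i'
  poc := D.po
  I' := O'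
  a_star := a
  i' := D.o'
  po := D.poc

/-- Vertical composition of transport diagrams. -/
def paste (D : TransDiagram r a) {b : O' ⟶ O''} (E : TransDiagram D.rule b) :
    TransDiagram r (a ≫ b) where
  K' := E.K'
  k := D.k ≫ E.k
  o' := E.o'
  poc := D.poc.paste_vert E.poc
  I' := E.I'
  a_star := D.a_star ≫ E.a_star
  i' := E.i'
  po := D.po.paste_vert E.po

theorem nonempty_of_isPushout {K' : C} {k : r.apex ⟶ K'} {o' : K' ⟶ O'}
    (h : IsPushout r.left k a o') : Nonempty (TransDiagram r a) := by
  have := MAdhesive.hasPushout r.right k r.right_mem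
  exact ⟨⟨K', k, o', h, _, _, _, IsPushout.of_hasPushout r.right k⟩⟩

/-- A transport diagram over `a ≫ u` restricts to one over `a`. -/
theorem restrict {a' : O ⟶ O''} (D : TransDiagram r a') (u : O' ⟶ O'') (hu : M u)
    (h : a ≫ u = a') : Nonempty (TransDiagram r a) := by
  subst h
  obtain ⟨_, _, _, h⟩ := MAdhesive.exists_pushoutComplement_restrict r.left_mem hu D.poc
  exact nonempty_of_isPushout h

section factor

variable (D : TransDiagram r a) {a' : O ⟶ O''} (D' : TransDiagram r a') (u : O' ⟶ O'')
  (hu : M u) (h : a ≫ u = a')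

-- The comparison of pushout complements gives `w`, and the universal property of the lower pushout
-- gives `v`. Cancelling the pushouts of `D` from those of `D'` leaves the two new squares.
include hu h in
theorem exists_factor :
    ∃ (w : D.K' ⟶ D'.K') (v : D.I' ⟶ D'.I'), D.k ≫ w = D'.k ∧ D.a_star ≫ v = D'.a_star ∧
      IsPushout D.o' w u D'.o' ∧ IsPushout D.i' w v D'.i' := by
  obtain ⟨w, hw, hp⟩ :=
    MAdhesive.exists_pushoutComplement_map D.poc D'.poc r.left_mem hu h
  have e : r.right ≫ D'.a_star = D.k ≫ w ≫ D'.i' := by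
    rw [D'.po.w, ← hw, Category.assoc]
  refine ⟨w, D.po.desc D'.a_star (w ≫ D'.i') e, hw, by simp, hp, ?_⟩
  refine IsPushout.of_top (h₁₁ := r.right) (v₁₁ := D.k) (v₁₂ := D.a_star) ?_ (by simp) D.po
  simpa [hw] using D'.po

/-- The morphism of middle objects induced by a factorization `a' = a ≫ u`. -/
noncomputable def mid : D.K' ⟶ D'.K' := (D.exists_factor D' u hu h).choose

/-- The morphism of input objects induced by a factorization `a' = a ≫ u`. -/
noncomputable def low : D.I' ⟶ D'.I' := (D.exists_factor D' u hu h).choose_spec.choose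

theorem a_star_low : D.a_star ≫ D.low D' u hu h = D'.a_star :=
  (D.exists_factor D' u hu h).choose_spec.choose_spec.2.1

theorem isPushout_mid : IsPushout D.o' (D.mid D' u hu h) u D'.o' :=
  (D.exists_factor D' u hu h).choose_spec.choose_spec.2.2.1

theorem isPushout_low : IsPushout D.i' (D.mid D' u hu h) (D.low D' u hu h) D'.i' :=
  (D.exists_factor D' u hu h).choose_spec.choose_spec.2.2.2

/-- If `a' = a ≫ u`, then a transport diagram over `a'` factors through any
transport diagram over `a`. -/
noncomputable def factor : TransDiagram D.rule u where
  K' := D'.K'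
  k := D.mid D' u hu h
  o' := D'.o'
  poc := D.isPushout_mid D' u hu h
  I' := D'.I'
  a_star := D.low D' u hu h
  i' := D'.i'
  po := D.isPushout_low D' u hu h

theorem low_mem : M (D.low D' u hu h) :=
  (D.factor D' u hu h).a_star_mem hu

/-- The lower morphism of a factorization is determined by compatibility. -/
theorem low_eq {w : D.K' ⟶ D'.K'} {v : D.I' ⟶ D'.I'} (hw : w ≫ D'.o' = D.o' ≫ u)
    (hv : D.a_star ≫ v = D'.a_star) (hwv : w ≫ D'.i' = D.i' ≫ v) :
    D.low D' u hu h = v := by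
  have := MAdhesive.mono_of_mem D'.o' D'.rule.left_mem
  have hk : D.mid D' u hu h = w := by
    rw [← cancel_mono D'.o', hw, (D.isPushout_mid D' u hu h).w]
  apply D.po.hom_ext
  · rw [hv, a_star_low]
  · rw [← hwv, ← hk, (D.isPushout_low D' u hu h).w]

/-- Passing to the input side and back returns the original morphism. This is what allows each
argument about chains to be reused for reversed chains. -/
theorem low_rev :
    D.rev.low D'.rev (D.low D' u hu h) (D.low_mem D' u hu h)
      (D.a_star_low D' u hu h) = u :=
  low_eq D.rev D'.rev _ _ _ (D.isPushout_low D' u hu h).w.symm h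
    (D.isPushout_mid D' u hu h).w.symm

theorem low_comp {O₃ : C} {a₃ : O ⟶ O₃} (D₃ : TransDiagram r a₃) (u' : O'' ⟶ O₃)
    (hu' : M u') (h' : a' ≫ u' = a₃) (u₃ : O' ⟶ O₃) (hu₃ : M u₃) (h₃ : a ≫ u₃ = a₃)
    (e : u ≫ u' = u₃) :
    D.low D' u hu h ≫ D'.low D₃ u' hu' h' = D.low D₃ u₃ hu₃ h₃ := by
  symm
  apply low_eq (w := D.mid D' u hu h ≫ D'.mid D₃ u' hu' h')
  · rw [Category.assoc, ← (D'.isPushout_mid D₃ u' hu' h').w, ← Category.assoc,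
      ← (D.isPushout_mid D' u hu h).w, Category.assoc, e]
  · rw [← Category.assoc, a_star_low, a_star_low]
  · rw [Category.assoc, ← (D'.isPushout_low D₃ u' hu' h').w, ← Category.assoc,
      ← (D.isPushout_low D' u hu h).w, Category.assoc]

theorem isIso_mid [IsIso u] : IsIso (D.mid D' u hu h) :=
  (MAdhesive.isPullback_of_isPushout (D.isPushout_mid D' u hu h)
    D.rule.left_mem).isIso_snd_of_isIso

theorem isIso_low [iso : IsIso u] : IsIso (D.low D' u hu h) :=
  have := D.isIso_mid D' u hu h
  (D.isPushout_low D' u hu h).isIso_inl_of_isIso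

theorem isIso_of_isIso_low [IsIso (D.low D' u hu h)] : IsIso u := by
  rw [← D.low_rev D' u hu h]
  exact isIso_low _ _ _ _ _

end factor

section comp

variable {N : C} {r₂ : LinearRule M O N} {r₁ : LinearRule M N I} {K : C}
  {l₂ : K ⟶ r₂.apex} {l₁ : K ⟶ r₁.apex} (pb : IsPullback l₂ l₁ r₂.right r₁.left)

omit [MAdhesive M] in
include pb in
theorem comp_aux (D₂ : TransDiagram r₂ a) (D₁ : TransDiagram r₁ D₂.a_star) :
    (l₂ ≫ D₂.k) ≫ D₂.i' = (l₁ ≫ D₁.k) ≫ D₁.o' := by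
  rw [Category.assoc, Category.assoc, ← D₂.po.w, ← D₁.poc.w, ← Category.assoc, pb.w,
    Category.assoc]

/-- Pull the pushout complement of `D₁` back along `D₂.i'`. Because `D₂.po` is also a pullback, `N`
pulls back to the apex of `r₂`, hence the apex of `r₁` to `K`. `comp_right` is the mirror image. -/
theorem comp_left (D₂ : TransDiagram r₂ a) (D₁ : TransDiagram r₁ D₂.a_star) {P : C}
    {p₂ : P ⟶ D₂.K'} {p₁ : P ⟶ D₁.K'} (hP : IsPullback p₂ p₁ D₂.i' D₁.o') :
    IsPushout l₂ (hP.lift _ _ (comp_aux pb D₂ D₁)) D₂.k p₂ :=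
  MAdhesive.isPushout_of_isPullback D₁.poc r₁.left_mem D₂.rule.right_mem
    (MAdhesive.isPullback_of_isPushout D₂.po r₂.right_mem).flip hP pb (by simp) (by simp)

theorem comp_right (D₂ : TransDiagram r₂ a) (D₁ : TransDiagram r₁ D₂.a_star) {P : C}
    {p₂ : P ⟶ D₂.K'} {p₁ : P ⟶ D₁.K'} (hP : IsPullback p₂ p₁ D₂.i' D₁.o') :
    IsPushout l₁ (hP.lift _ _ (comp_aux pb D₂ D₁)) D₁.k p₁ :=
  MAdhesive.isPushout_of_isPullback D₂.po r₂.right_mem D₁.rule.left_mem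
    (MAdhesive.isPullback_of_isPushout D₁.poc r₁.left_mem).flip hP.flip pb.flip
      (by simp) (by simp)

/-- Horizontal composition of transport diagrams. -/
noncomputable def comp (D₂ : TransDiagram r₂ a) (D₁ : TransDiagram r₁ D₂.a_star) {P : C}
    {p₂ : P ⟶ D₂.K'} {p₁ : P ⟶ D₁.K'} (hP : IsPullback p₂ p₁ D₂.i' D₁.o') :
    TransDiagram (MSpan.comp r₂ r₁ pb) a where
  K' := P
  k := hP.lift _ _ (comp_aux pb D₂ D₁)
  o' := p₂ ≫ D₂.o'
  poc := (comp_left pb D₂ D₁ hP).paste_horiz D₂.poc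
  I' := D₁.I'
  a_star := D₁.a_star
  i' := p₁ ≫ D₁.i'
  po := (comp_right pb D₂ D₁ hP).paste_horiz D₁.po

/-- A transport diagram for a composite rule decomposes. -/
theorem decomp (D : TransDiagram (MSpan.comp r₂ r₁ pb) a) :
    ∃ D₂ : TransDiagram r₂ a, Nonempty (TransDiagram r₁ D₂.a_star) := by
  obtain ⟨P, k, o', poc, -, -, -, -⟩ := D
  have hl₂ : M l₂ := MAdhesive.pullback_mem pb r₁.left_mem
  have hl₁ : M l₁ := MAdhesive.pullback_mem pb.flip r₂.right_mem
  change K ⟶ P at k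
  change IsPushout (l₂ ≫ r₂.left) k a o' at poc
  -- The middle objects for the two factors are the pushouts of `K ⟶ P` along `l₂` and `l₁`. The
  -- equality `pb.w` lets the same outer pushout be cancelled on either side.
  have := MAdhesive.hasPushout l₂ k hl₂
  have := MAdhesive.hasPushout l₁ k hl₁
  have h₂ := IsPushout.of_hasPushout l₂ k
  have h₁ := IsPushout.of_hasPushout l₁ k
  have hp₂ := IsPushout.of_left' poc h₂
  have := MAdhesive.hasPushout r₂.right (pushout.inl l₂ k) r₂.right_mem
  have hq := IsPushout.of_hasPushout r₂.right (pushout.inl l₂ k)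
  have hq' := h₂.paste_horiz hq
  rw [pb.w] at hq'
  have hp₁ := IsPushout.of_left' hq' h₁
  exact ⟨⟨_, _, _, hp₂, _, _, _, hq⟩, nonempty_of_isPushout hp₁⟩

end comp

end TransDiagram

/-! ## Semantics of the shift construction -/

omit [MAdhesive M] in
theorem Condition.sat_disj {P H : C} {J : Type (max u v)} {c : J → Condition M P} {p : P ⟶ H} :
    (Condition.disj J c).Sat p ↔ ∃ j, (c j).Sat p := by
  simp [Condition.disj, Condition.Sat]

omit [MAdhesive M] in
theorem Condition.sat_ex {P Q H : C} {a : P ⟶ Q} {ha : M a} {c : Condition M Q} {p : P ⟶ H} :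
    (Condition.ex a ha c).Sat p ↔ ∃ q : Q ⟶ H, M q ∧ a ≫ q = p ∧ c.Sat q :=
  Iff.rfl

omit [MAdhesive M] in
theorem Condition.sat_and {P H : C} {c d : Condition M P} {p : P ⟶ H} :
    (c.and d).Sat p ↔ c.Sat p ∧ d.Sat p := by
  refine ⟨fun h => ⟨h ⟨.true⟩, h ⟨.false⟩⟩, ?_⟩
  rintro ⟨h₁, h₂⟩ ⟨_ | _⟩
  exacts [h₂, h₁]

/-- The union of two `M`-subobjects. -/
theorem HasMEffectiveUnions.exists_union (hunion : HasMEffectiveUnions M) {B X E : C}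
    {b : B ⟶ E} {c : X ⟶ E} (hb : M b) (hc : M c) :
    ∃ (A : C) (b' : A ⟶ B) (c' : A ⟶ X) (D : C) (e : B ⟶ D) (f : X ⟶ D) (d : D ⟶ E),
      M b' ∧ M c' ∧ M d ∧ IsPushout b' c' e f ∧ IsPullback b' c' b c ∧ e ≫ d = b ∧ f ≫ d = c := by
  have := MAdhesive.hasPullback b c hb
  have hP := IsPullback.of_hasPullback b c
  have h₁ := MAdhesive.pullback_mem hP hc
  have h₂ := MAdhesive.pullback_mem hP.flip hb
  have := MAdhesive.hasPushout _ (pullback.snd b c) h₁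
  have hQ := IsPushout.of_hasPushout (pullback.fst b c) (pullback.snd b c)
  have e₁ := hQ.inl_desc b c hP.w
  have e₂ := hQ.inr_desc b c hP.w
  exact ⟨_, _, _, _, _, _, _, h₁, h₂, hunion _ _ _ _ _ _ _ h₁ h₂
    (MAdhesive.pushout_mem hQ.flip h₂) (MAdhesive.pushout_mem hQ h₁) hb hc hQ hP e₁ e₂,
    hQ, hP, e₁, e₂⟩

/-- An extension `q` of `p ≫ m` along `a` and the morphism `m` are two `M`-subobjects of `H`. Their
intersection and union form one of the squares over which the shift ranges, the union being an
`M`-subobject by effectiveness. -/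
theorem Condition.sat_shift (hunion : HasMEffectiveUnions M) {P : C} (c : Condition M P) :
    ∀ {Q H : C} (p : P ⟶ Q) (m : Q ⟶ H), M p → M m → ((c.shift p).Sat m ↔ c.Sat (p ≫ m)) := by
  induction c with
  | true P => intros; rfl
  | @ex P A a ha c ih =>
    intro Q H p m hp hm
    rw [Condition.shift, Condition.sat_disj]
    constructor
    · rintro ⟨D, e, he, hre, hc⟩
      have hs := MAdhesive.pushout_mem D.isPushout D.p₂_mem
      refine ⟨D.s ≫ e, MAdhesive.comp_mem _ _ hs he, ?_, (ih _ _ hs he).mp hc⟩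
      have h : a ≫ D.s = p ≫ D.r := by
        have h₁ := D.x ≫= D.isPushout.w
        rw [← Category.assoc, ← Category.assoc, D.fac_p, D.fac_a] at h₁
        exact h₁.symm
      rw [← hre, ← Category.assoc, h, Category.assoc]
    · rintro ⟨q, hq, hqa, hc⟩
      obtain ⟨X, p₂, a₂, E, r, s, e, hp₂, ha₂, he, hpo, hpb, hre, hse⟩ :=
        hunion.exists_union hm hq
      have h₁ := hpb.lift_fst p a hqa.symm
      have h₂ := hpb.lift_snd p a hqa.symm
      refine ⟨⟨X, hpb.lift p a hqa.symm, p₂, a₂,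
        MAdhesive.decomp_mem _ p₂ (by rwa [h₁]) hp₂, hp₂, ha₂, h₁, h₂, E, r, s, hpo⟩,
        Condition.sat_ex.mpr ⟨e, he, hre, ?_⟩⟩
      refine (ih _ _ (MAdhesive.pushout_mem hpo hp₂) he).mpr ?_
      rwa [hse]
  | neg c ih => intro Q H p m hp hm; exact not_congr (ih p m hp hm)
  | conj J c ih => intro Q H p m hp hm; exact forall_congr' fun j => ih j p m hp hm

/-! ## Semantics of the transport construction -/

/-- Unions of objects along which a rule is applicable: the rule is applicable along
the union. -/
theorem TransDiagram.exists_union (hunion : HasMEffectiveUnions M) {O I : C}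
    {r : LinearRule M O I} {O₁ O₂ H : C} {a₁ : O ⟶ O₁} {a₂ : O ⟶ O₂} {j₁ : O₁ ⟶ H} {j₂ : O₂ ⟶ H}
    (D₁ : TransDiagram r a₁) (D₂ : TransDiagram r a₂) (h₁ : M j₁) (h₂ : M j₂)
    (e : a₁ ≫ j₁ = a₂ ≫ j₂) :
    ∃ (J : C) (t₁ : O₁ ⟶ J) (t₂ : O₂ ⟶ J) (j : J ⟶ H), M j ∧ t₁ ≫ j = j₁ ∧ t₂ ≫ j = j₂ ∧
      Nonempty (TransDiagram r (a₁ ≫ t₁)) := by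
  obtain ⟨X, b₁, b₂, J, t₁, t₂, j, hb₁, hb₂, hj, hpo, hpb, ht₁, ht₂⟩ := hunion.exists_union h₁ h₂
  refine ⟨J, t₁, t₂, j, hj, ht₁, ht₂, ?_⟩
  have e₁ := hpb.lift_fst a₁ a₂ e
  have e₂ := hpb.lift_snd a₁ a₂ e
  -- The rule is applicable along the intersection `X`. The complement for the union is the pushout
  -- of the complements for `O₁` and `O₂` over that for `X`.
  obtain ⟨D⟩ := D₁.restrict b₁ hb₁ e₁
  have s₁ := D.isPushout_mid D₁ b₁ hb₁ e₁
  have s₂ := D.isPushout_mid D₂ b₂ hb₂ e₂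
  have hm₁ : M (D.mid D₁ b₁ hb₁ e₁) := by
    refine MAdhesive.decomp_mem _ D₁.o' ?_ D₁.rule.left_mem
    rw [← s₁.w]
    exact MAdhesive.comp_mem _ _ D.rule.left_mem hb₁
  have := MAdhesive.hasPushout _ (D.mid D₂ b₂ hb₂ e₂) hm₁
  have hL := IsPushout.of_hasPushout (D.mid D₁ b₁ hb₁ e₁) (D.mid D₂ b₂ hb₂ e₂)
  have h₃ := s₂.paste_horiz hpo
  rw [s₁.w] at h₃
  exact TransDiagram.nonempty_of_isPushout (D₁.poc.paste_vert (h₃.of_left' hL))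

/-- A presentation of the greatest `M`-subobject `J` of `H` through which `p : I ⟶ H` factors
and along which the rule `r` is applicable to `I`, together with the transformation. -/
structure MaxDerivation {O I H : C} (r : LinearRule M O I) (p : I ⟶ H) where
  J : C
  e : I ⟶ J
  j : J ⟶ H
  j_mem : M j
  fac : e ≫ j = p
  T : TransDiagram r.rev e
  max : ∀ ⦃J' : C⦄ (e' : I ⟶ J') (j' : J' ⟶ H), M j' → e' ≫ j' = p →
    Nonempty (TransDiagram r.rev e') → ∃ t : J' ⟶ J, t ≫ j = j'

namespace MaxDerivation

variable {O I H O' : C} {r : LinearRule M O I} {p : I ⟶ H}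

theorem e_mem (D : MaxDerivation r p) (hp : M p) : M D.e :=
  MAdhesive.decomp_mem _ D.j (by rw [D.fac]; exact hp) D.j_mem

theorem out_mem (D : MaxDerivation r p) (hp : M p) : M D.T.a_star :=
  D.T.a_star_mem (D.e_mem hp)

/-- The subobjects of `H` on which the reversed rule is applicable are finite in number and closed
under binary unions, so a maximal one is greatest. -/
theorem nonempty (hunion : HasMEffectiveUnions M) (hfin : IsMFinitary M) (r : LinearRule M O I)
    (hp : M p) : Nonempty (MaxDerivation r p) := by
  have := hfin H
  let P : Set {S : Subobject H // M S.arrow} := {S | ∃ e : I ⟶ (S.1 : C), e ≫ S.1.arrow = p ∧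
    Nonempty (TransDiagram r.rev e)}
  have mk {J : C} (e : I ⟶ J) (j : J ⟶ H) (hj : M j) (he : e ≫ j = p)
      (T : Nonempty (TransDiagram r.rev e)) :
      ∃ S ∈ P, ∃ t : J ⟶ (S.1 : C), t ≫ S.1.arrow = j := by
    have := MAdhesive.mono_of_mem j hj
    have hS : M (Subobject.mk j).arrow := by
      rw [← Subobject.underlyingIso_hom_comp_eq_mk]
      exact MAdhesive.comp_mem _ _ (MAdhesive.mem_of_isIso _ inferInstance) hj
    refine ⟨⟨Subobject.mk j, hS⟩, ⟨e ≫ (Subobject.underlyingIso j).inv, by simpa, ?_⟩,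
      (Subobject.underlyingIso j).inv, by simp⟩
    obtain ⟨T⟩ := T
    refine TransDiagram.nonempty_of_isPushout (k := T.k)
      (o' := T.o' ≫ (Subobject.underlyingIso j).inv) ?_
    have h := T.poc.paste_vert (IsPushout.of_vert_isIso (f := T.o') (g := 𝟙 _)
      (inl := (Subobject.underlyingIso j).inv)
      (inr := T.o' ≫ (Subobject.underlyingIso j).inv) ⟨by simp⟩)
    simpa using h
  -- The family is nonempty: it contains `I` itself, transformed by the bare rule.
  obtain ⟨S₀, hS₀, -⟩ := mk (𝟙 I) p hp (by simp) ⟨⟨_, 𝟙 _, r.right,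
    IsPushout.of_vert_isIso ⟨by simp [MSpan.rev]⟩, O, 𝟙 _, r.left,
    IsPushout.of_vert_isIso ⟨by simp [MSpan.rev]⟩⟩⟩
  obtain ⟨S, hS⟩ := (Set.toFinite P).exists_maximal ⟨S₀, hS₀⟩
  obtain ⟨e, he, ⟨T⟩⟩ := hS.prop
  refine ⟨⟨_, e, S.1.arrow, S.2, he, T, ?_⟩⟩
  rintro J' e' j' hj' he' ⟨T'⟩
  obtain ⟨J, t₁, t₂, j, hj, ht₁, ht₂, hT⟩ := T.exists_union hunion T' S.2 hj' (he.trans he'.symm)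
  obtain ⟨S', hS', t, ht⟩ := mk _ j hj (by rw [Category.assoc, ht₁, he]) hT
  have hle : S ≤ S' := Subobject.le_of_comm (t₁ ≫ t) (by rw [Category.assoc, ht, ht₁])
  have hge : S'.1 ≤ S.1 := hS.le_of_ge hS' hle
  exact ⟨t₂ ≫ t ≫ Subobject.ofLE _ _ hge, by simp [ht, ht₂]⟩

/-- The greatest derivation restricts along transport diagrams that factor `p`. -/
def extend (D : MaxDerivation r p) {a : O ⟶ O'} (D₀ : TransDiagram r a) (t : D₀.I' ⟶ D.J)
    (q : D₀.I' ⟶ H) (T : TransDiagram D₀.rule.rev t) (hq : t ≫ D.j = q)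
    (h : D₀.a_star ≫ q = p) : MaxDerivation D₀.rule q where
  J := D.J
  e := t
  j := D.j
  j_mem := D.j_mem
  fac := hq
  T := T
  max := by
    rintro J' e' j' hj' he' ⟨T'⟩
    refine D.max (D₀.a_star ≫ e') j' hj' (by rw [Category.assoc, he', h]) ⟨D₀.rev.paste T'⟩

/-- The greatest derivation over the target of a transport diagram is one over its source. -/
def ofExtension (hunion : HasMEffectiveUnions M) {a : O ⟶ O'} (E : TransDiagram r a)
    {m : E.I' ⟶ H} (hm : M m) (D : MaxDerivation E.rule m) :
    MaxDerivation r (E.a_star ≫ m) where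
  J := D.J
  e := E.a_star ≫ D.e
  j := D.j
  j_mem := D.j_mem
  fac := by rw [Category.assoc, D.fac]
  T := E.rev.paste D.T
  max := by
    rintro J' e' j' hj' he' ⟨T'⟩
    -- A competitor `J'` need not contain `E.I'`. Its union with `E.I'` still admits the reversed
    -- rule and lies over `E.I'`, so it is bounded by `D.J`.
    obtain ⟨J, t₁, t₂, j, hj, ht₁, ht₂, ⟨T''⟩⟩ :=
      E.rev.exists_union hunion T' hm hj' he'.symm
    have ht : M t₁ := MAdhesive.decomp_mem _ j (by rwa [ht₁]) hj
    obtain ⟨t, ht⟩ := D.max t₁ j hj ht₁ ⟨E.rev.factor T'' t₁ ht rfl⟩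
    exact ⟨t₂ ≫ t, by rw [Category.assoc, ht, ht₂]⟩

end MaxDerivation

/-- In the existential case, an extension `q` of `p` over which the transformation exists lands in
`D.J` by maximality, and is carried to the output of `D.T`; conversely an extension in that output
is carried back into `D.J`. The induction proceeds because `D.J` stays greatest for the extended
rule (`MaxDerivation.extend`). -/
theorem Condition.sat_trans_iff {O : C} (c : Condition M O) :
    ∀ {I H : C} {r : LinearRule M O I} {p : I ⟶ H} (D : MaxDerivation r p),
      (c.trans r).Sat p ↔ c.Sat D.T.a_star := by
  induction c with
  | true P => intros; rfl
  | @ex O O' a ha c ih =>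
    intro I H r p D
    constructor
    · intro h
      by_cases hD : Nonempty (TransDiagram r a)
      · rw [Condition.trans, dif_pos hD] at h
        set D₀ := hD.some
        obtain ⟨q, hq, hqa, hc⟩ := h
        obtain ⟨t, ht⟩ := D.max D₀.a_star q hq hqa ⟨D₀.rev⟩
        have hMt : M t := MAdhesive.decomp_mem _ D.j (by rwa [ht]) D.j_mem
        have := MAdhesive.mono_of_mem _ D.j_mem
        have he : D₀.a_star ≫ t = D.e := by
          rw [← cancel_mono D.j, Category.assoc, ht, hqa, D.fac]
        let E := D₀.rev.factor D.T t hMt he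
        exact ⟨E.a_star, E.a_star_mem hMt, D₀.rev.a_star_low D.T t hMt he,
          (ih (D.extend D₀ t q E ht hqa)).mp hc⟩
      · rw [Condition.trans, dif_neg hD] at h
        exact absurd trivial h
    · rintro ⟨q, hq, hqa, hc⟩
      obtain hD : Nonempty (TransDiagram r a) :=
        TransDiagram.restrict (r := r) D.T.rev q hq hqa
      rw [Condition.trans, dif_pos hD]
      set D₀ := hD.some
      let E : TransDiagram D₀.rule q := D₀.factor (r := r) D.T.rev q hq hqa
      have hE : D₀.a_star ≫ E.a_star = D.e := D₀.a_star_low (r := r) D.T.rev q hq hqa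
      have hpe : D₀.a_star ≫ E.a_star ≫ D.j = p :=
        (Category.assoc _ _ _).symm.trans ((congrArg (· ≫ D.j) hE).trans D.fac)
      exact ⟨E.a_star ≫ D.j, MAdhesive.comp_mem _ _ (E.a_star_mem hq) D.j_mem, hpe,
        (ih (D.extend D₀ E.a_star _ E.rev rfl hpe)).mpr hc⟩
  | neg c ih => intro I H r p D; exact not_congr (ih D)
  | conj J c ih => intro I H r p D; exact forall_congr' fun j => ih j D

theorem Condition.sat_and_trans {O I H : C} {c d : Condition M O} {r : LinearRule M O I}
    {p : I ⟶ H} : ((c.and d).trans r).Sat p ↔ (c.trans r).Sat p ∧ (d.trans r).Sat p := by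
  refine ⟨fun h => ⟨h ⟨.true⟩, h ⟨.false⟩⟩, ?_⟩
  rintro ⟨h₁, h₂⟩ ⟨_ | _⟩
  exacts [h₂, h₁]

section

variable (hunion : HasMEffectiveUnions M) (hfin : IsMFinitary M)
include hunion hfin

/-- Transport is defined by recursion on syntax, but by `Condition.sat_trans_iff` its truth depends
only on the semantics of the condition. -/
theorem Condition.Equivalent.trans {O I : C} {c d : Condition M O} (h : c.Equivalent d)
    (r : LinearRule M O I) : (c.trans r).Equivalent (d.trans r) := by
  intro H p hp
  obtain ⟨D⟩ := MaxDerivation.nonempty hunion hfin r hp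
  rw [Condition.sat_trans_iff _ D, Condition.sat_trans_iff _ D]
  exact h _ _ (D.out_mem hp)

/-- Transport commutes with shift. -/
theorem Condition.sat_shift_trans {O I O' H : C} {r : LinearRule M O I} {a : O ⟶ O'} (ha : M a)
    (E : TransDiagram r a) (c : Condition M O) {m : E.I' ⟶ H} (hm : M m) :
    ((c.shift a).trans E.rule).Sat m ↔ (c.trans r).Sat (E.a_star ≫ m) := by
  obtain ⟨D⟩ := MaxDerivation.nonempty hunion hfin E.rule hm
  rw [Condition.sat_trans_iff _ D,
    Condition.sat_trans_iff _ (MaxDerivation.ofExtension hunion E hm D),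
    Condition.sat_shift hunion _ _ _ ha (D.out_mem hm)]
  rfl

/-- The transport of an existential condition, by means of any transport diagram. -/
theorem Condition.sat_ex_trans {O I O' H : C} {r : LinearRule M O I} {a : O ⟶ O'} (ha : M a)
    (c : Condition M O') (D : TransDiagram r a) {p : I ⟶ H} :
    ((Condition.ex a ha c).trans r).Sat p ↔
      ∃ q : D.I' ⟶ H, M q ∧ D.a_star ≫ q = p ∧ (c.trans D.rule).Sat q := by
  have hD : Nonempty (TransDiagram r a) := ⟨D⟩
  rw [Condition.trans, dif_pos hD]
  set D₀ := hD.some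
  -- The definition of transport uses a chosen diagram; any two diagrams over `a` are compared by
  -- factoring one through the other along the identity of `O'`.
  have key (D₁ D₂ : TransDiagram r a) (q : D₂.I' ⟶ H) (hq : M q) (hqp : D₂.a_star ≫ q = p)
      (hc : (c.trans D₂.rule).Sat q) :
      ∃ q : D₁.I' ⟶ H, M q ∧ D₁.a_star ≫ q = p ∧ (c.trans D₁.rule).Sat q := by
    have h1 : M (𝟙 O') := MAdhesive.mem_of_isIso _ inferInstance
    let E := D₁.factor D₂ (𝟙 O') h1 (by simp)
    have hE : D₁.a_star ≫ E.a_star = D₂.a_star := D₁.a_star_low D₂ _ h1 (by simp)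
    refine ⟨E.a_star ≫ q, MAdhesive.comp_mem _ _ (E.a_star_mem h1) hq,
      (Category.assoc _ _ _).symm.trans ((congrArg (· ≫ q) hE).trans hqp), ?_⟩
    rw [← Condition.sat_shift_trans hunion hfin h1 E c hq]
    refine (Condition.Equivalent.trans hunion hfin (d := c) ?_ E.rule H q hq).mpr hc
    intro H p hp
    rw [Condition.sat_shift hunion _ _ _ h1 hp, Category.id_comp]
  constructor
  · rintro ⟨q, hq, hqp, hc⟩
    exact key D D₀ q hq hqp hc
  · rintro ⟨q, hq, hqp, hc⟩
    exact key D₀ D q hq hqp hc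

/-- Transport over a composite rule is iterated transport. -/
theorem Condition.trans_trans_equivalent {O : C} (c : Condition M O) :
    ∀ {N I K : C} {r₂ : LinearRule M O N} {r₁ : LinearRule M N I} {l₂ : K ⟶ r₂.apex}
      {l₁ : K ⟶ r₁.apex} (pb : IsPullback l₂ l₁ r₂.right r₁.left),
      ((c.trans r₂).trans r₁).Equivalent (c.trans (MSpan.comp r₂ r₁ pb)) := by
  induction c with
  | true P => intros; intro _ _ _; rfl
  | @ex O O' a ha c ih =>
    intro N I K r₂ r₁ l₂ l₁ pb H p hp
    by_cases hD₂ : Nonempty (TransDiagram r₂ a)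
    · have e : (Condition.ex a ha c).trans r₂ =
          .ex hD₂.some.a_star (hD₂.some.a_star_mem ha) (c.trans hD₂.some.rule) := by
        rw [Condition.trans, dif_pos hD₂]
      rw [e]
      set D₂ := hD₂.some
      by_cases hD₁ : Nonempty (TransDiagram r₁ D₂.a_star)
      · obtain ⟨D₁⟩ := hD₁
        have := MAdhesive.hasPullback D₂.i' D₁.o' D₂.rule.right_mem
        have hP := IsPullback.of_hasPullback D₂.i' D₁.o'
        rw [Condition.sat_ex_trans hunion hfin _ _ D₁,
          Condition.sat_ex_trans hunion hfin _ _ (TransDiagram.comp pb D₂ D₁ hP)]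
        refine exists_congr fun q => and_congr_right fun hq => and_congr_right fun _ => ?_
        exact ih (r₂ := D₂.rule) (r₁ := D₁.rule) hP H q hq
      · have hD : ¬ Nonempty (TransDiagram (MSpan.comp r₂ r₁ pb) a) := by
          rintro ⟨D⟩
          obtain ⟨D₂', ⟨D₁'⟩⟩ := TransDiagram.decomp pb D
          have h1 : M (𝟙 O') := MAdhesive.mem_of_isIso _ inferInstance
          exact hD₁ (D₁'.restrict (D₂.low D₂' (𝟙 O') h1 (by simp)) (D₂.low_mem _ _ _ _)
            (D₂.a_star_low _ _ _ _))
        rw [Condition.trans, dif_neg hD₁, Condition.trans, dif_neg hD]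
    · have hD : ¬ Nonempty (TransDiagram (MSpan.comp r₂ r₁ pb) a) := by
        rintro ⟨D⟩
        obtain ⟨D₂', -⟩ := TransDiagram.decomp pb D
        exact hD₂ ⟨D₂'⟩
      have e : (Condition.ex a ha c).trans r₂ = .false N := by
        rw [Condition.trans, dif_neg hD₂]
      rw [e, Condition.trans, dif_neg hD]
      rfl
  | neg c ih => intro N I K r₂ r₁ l₂ l₁ pb H p hp; exact not_congr (ih pb H p hp)
  | conj J c ih =>
    intro N I K r₂ r₁ l₂ l₁ pb H p hp; exact forall_congr' fun j => ih j pb H p hp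

end

/-! ## Composition diagrams of linear rules -/

/-- The composition diagram of two linear rules along a span, arranged into two
transport diagrams. It is symmetric under reversal of the rules. -/
structure CompositionData {O₂ I₂ O₁ I₁ : C} (r₂ : LinearRule M O₂ I₂) (r₁ : LinearRule M O₁ I₁)
    (μ : MSpan M I₂ O₁) where
  N : C
  m₂ : I₂ ⟶ N
  m₁ : O₁ ⟶ N
  po : IsPushout μ.left μ.right m₂ m₁
  upper : TransDiagram r₂.rev m₂
  lower : TransDiagram r₁ m₁
  K : C
  l₂ : K ⟶ upper.K'
  l₁ : K ⟶ lower.K'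
  pb : IsPullback l₂ l₁ upper.o' lower.o'

namespace CompositionData

variable {O₂ I₂ O₁ I₁ : C} {r₂ : LinearRule M O₂ I₂} {r₁ : LinearRule M O₁ I₁}
  {μ : MSpan M I₂ O₁} (D : CompositionData r₂ r₁ μ)

/-- The composition diagram of the reversed rules. -/
def rev : CompositionData r₁.rev r₂.rev μ.rev where
  N := D.N
  m₂ := D.m₁
  m₁ := D.m₂
  po := D.po.flip
  upper := D.lower
  lower := D.upper
  K := D.K
  l₂ := D.l₁
  l₁ := D.l₂
  pb := D.pb.flip

/-- The composite linear rule. -/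
def rule : LinearRule M D.upper.I' D.lower.I' :=
  MSpan.comp D.upper.rule.rev D.lower.rule D.pb

/-- The composite application condition. -/
noncomputable def cond (c₂ : Condition M I₂) (c₁ : Condition M I₁) : Condition M D.lower.I' :=
  (c₁.shift D.lower.a_star).and ((c₂.shift D.m₂).trans D.lower.rule)

theorem m₂_mem : M D.m₂ := MAdhesive.pushout_mem D.po.flip μ.right_mem

theorem m₁_mem : M D.m₁ := MAdhesive.pushout_mem D.po μ.left_mem

/-- Evaluates the composite condition inside any larger transformation `T` of `r₁` whose output
contains `N`: the result depends only on `T` and on `i`, no longer on `N`. -/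
theorem sat_cond (hunion : HasMEffectiveUnions M) (hfin : IsMFinitary M) (c₂ : Condition M I₂)
    (c₁ : Condition M I₁) {X : C} {o : O₁ ⟶ X} (T : TransDiagram r₁ o) (u : D.N ⟶ X) (hu : M u)
    (h₁ : D.m₁ ≫ u = o) {i : I₂ ⟶ X} (h₂ : D.m₂ ≫ u = i) {H : C} {m : T.I' ⟶ H} (hm : M m) :
    (D.cond c₂ c₁).Sat (D.lower.low T u hu h₁ ≫ m) ↔
      c₁.Sat (T.a_star ≫ m) ∧ ((c₂.shift i).trans T.rule).Sat m := by
  subst h₂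
  have hl := MAdhesive.comp_mem _ _ (D.lower.low_mem T u hu h₁) hm
  rw [cond, Condition.sat_and,
    Condition.sat_shift hunion _ _ _ (D.lower.a_star_mem D.m₁_mem) hl, ← Category.assoc,
    TransDiagram.a_star_low]
  refine and_congr_right fun _ => ?_
  refine (Condition.sat_shift_trans hunion hfin hu (D.lower.factor T u hu h₁) _ hm).symm.trans ?_
  refine Condition.Equivalent.trans hunion hfin ?_ _ _ _ hm
  intro H p hp
  rw [Condition.sat_shift hunion _ _ _ hu hp,
    Condition.sat_shift hunion _ _ _ D.m₂_mem (MAdhesive.comp_mem _ _ hu hp),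
    Condition.sat_shift hunion _ _ _ (MAdhesive.comp_mem _ _ D.m₂_mem hu) hp, Category.assoc]

/-- Composites are unique up to isomorphism. -/
theorem exists_iso (hunion : HasMEffectiveUnions M) (hfin : IsMFinitary M)
    (D D' : CompositionData r₂ r₁ μ) : ∃ e : LinearRule.Iso D.rule D'.rule,
      ∀ (c₂ : Condition M I₂) (c₁ : Condition M I₁) (H : C) (m : D.lower.I' ⟶ H), M m →
        ((D.cond c₂ c₁).Sat m ↔ (D'.cond c₂ c₁).Sat (e.ι.inv ≫ m)) := by
  let θ := D.po.isoIsPushout _ _ D'.po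
  have h₂ : D.m₂ ≫ θ.hom = D'.m₂ := D.po.inl_isoIsPushout_hom _ _ D'.po
  have h₁ : D.m₁ ≫ θ.hom = D'.m₁ := D.po.inr_isoIsPushout_hom _ _ D'.po
  have hθ : M θ.hom := MAdhesive.mem_of_isIso _ inferInstance
  have := D.upper.isIso_mid D'.upper θ.hom hθ h₂
  have := D.upper.isIso_low D'.upper θ.hom hθ h₂
  have := D.lower.isIso_mid D'.lower θ.hom hθ h₁
  have := D.lower.isIso_low D'.lower θ.hom hθ h₁
  have hpb : IsPullback (D.l₂ ≫ D.upper.mid D'.upper θ.hom hθ h₂)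
      (D.l₁ ≫ D.lower.mid D'.lower θ.hom hθ h₁) D'.upper.o' D'.lower.o' :=
    D.pb.of_iso (Iso.refl _) (asIso (D.upper.mid D'.upper θ.hom hθ h₂))
      (asIso (D.lower.mid D'.lower θ.hom hθ h₁)) θ (by simp) (by simp)
      (D.upper.isPushout_mid D'.upper θ.hom hθ h₂).w
      (D.lower.isPushout_mid D'.lower θ.hom hθ h₁).w
  let κ : D.K ≅ D'.K := hpb.isoIsPullback _ _ D'.pb
  have hκ₂ : κ.hom ≫ D'.l₂ ≫ D'.upper.i' =
      (D.l₂ ≫ D.upper.i') ≫ D.upper.low D'.upper θ.hom hθ h₂ := by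
    rw [← Category.assoc, hpb.isoIsPullback_hom_fst, Category.assoc, Category.assoc,
      (D.upper.isPushout_low D'.upper θ.hom hθ h₂).w]
  have hκ₁ : κ.hom ≫ D'.l₁ ≫ D'.lower.i' =
      (D.l₁ ≫ D.lower.i') ≫ D.lower.low D'.lower θ.hom hθ h₁ := by
    rw [← Category.assoc, hpb.isoIsPullback_hom_snd, Category.assoc, Category.assoc,
      (D.lower.isPushout_low D'.lower θ.hom hθ h₁).w]
  let e : LinearRule.Iso D.rule D'.rule :=
    { ω := asIso (D.upper.low D'.upper θ.hom hθ h₂)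
      κ := κ
      ι := asIso (D.lower.low D'.lower θ.hom hθ h₁)
      left_comm := hκ₂
      right_comm := hκ₁ }
  refine ⟨e, fun c₂ c₁ H m hm => ?_⟩
  have hm' : M (e.ι.inv ≫ m) :=
    MAdhesive.comp_mem _ _ (MAdhesive.mem_of_isIso _ inferInstance) hm
  have h := D.sat_cond hunion hfin c₂ c₁ D'.lower θ.hom hθ h₁ h₂ hm'
  have h' : D.lower.low D'.lower θ.hom hθ h₁ ≫ e.ι.inv ≫ m = m := by
    rw [← Category.assoc]
    exact (congrArg (· ≫ m) e.ι.hom_inv_id).trans (Category.id_comp m)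
  rw [h'] at h
  rw [h, cond, Condition.sat_and,
    Condition.sat_shift hunion _ _ _ (D'.lower.a_star_mem D'.m₁_mem) hm']

end CompositionData

/-- The composition diagram of rules with conditions, rearranged. -/
def CompDiagram.data {R₂ R₁ : RuleAC M} {μ : MSpan M R₂.I R₁.O} (D : CompDiagram R₂ R₁ μ) :
    CompositionData R₂.rule R₁.rule μ where
  N := D.N
  m₂ := D.m₂'
  m₁ := D.m₁'
  po := D.po_N
  upper := ⟨D.K₂', D.k₂, D.n₂, D.poc₂, D.O₂₁, D.p₂, D.o₂', D.po₂⟩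
  lower := ⟨D.K₁', D.k₁, D.n₁, D.poc₁, D.I₂₁, D.p₁, D.i₁', D.po₁⟩
  K := D.K₂₁
  l₂ := D.l₂
  l₁ := D.l₁
  pb := D.pb

/-- The composition diagram of rules with conditions, from that of the linear rules. -/
def CompositionData.diagram {R₂ R₁ : RuleAC M} {μ : MSpan M R₂.I R₁.O}
    (D : CompositionData R₂.rule R₁.rule μ) : CompDiagram R₂ R₁ μ where
  N := D.N
  m₂' := D.m₂
  m₁' := D.m₁
  po_N := D.po
  K₂' := D.upper.K'
  k₂ := D.upper.k
  n₂ := D.upper.o'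
  poc₂ := D.upper.poc
  K₁' := D.lower.K'
  k₁ := D.lower.k
  n₁ := D.lower.o'
  poc₁ := D.lower.poc
  O₂₁ := D.upper.I'
  p₂ := D.upper.a_star
  o₂' := D.upper.i'
  po₂ := D.upper.po
  I₂₁ := D.lower.I'
  p₁ := D.lower.a_star
  i₁' := D.lower.i'
  po₁ := D.lower.po
  K₂₁ := D.K
  l₂ := D.l₂
  l₁ := D.l₁
  pb := D.pb

/-! ## Chains of three transformations -/

/-- A chain of three transformations `X₀ ⇒ X₁ ⇒ X₂ ⇒ X₃` by linear rules, with the pullbacks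
of the middle objects. Here `T₁` relates `X₀` and `X₁`, `T₂` relates `X₁` and `X₂`, and
`T₃` relates `X₂` and `X₃`. -/
structure Chain {O₁ I₁ O₂ I₂ O₃ I₃ : C} (r₁ : LinearRule M O₁ I₁) (r₂ : LinearRule M O₂ I₂)
    (r₃ : LinearRule M O₃ I₃) where
  X₁ : C
  o₁ : O₁ ⟶ X₁
  i₂ : I₂ ⟶ X₁
  o₁_mem : M o₁
  i₂_mem : M i₂
  T₂ : TransDiagram r₂.rev i₂
  i₃ : I₃ ⟶ T₂.I'
  i₃_mem : M i₃
  T₁ : TransDiagram r₁ o₁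
  T₃ : TransDiagram r₃.rev i₃
  P₂₁ : C
  a : P₂₁ ⟶ T₂.K'
  b : P₂₁ ⟶ T₁.K'
  pb₂₁ : IsPullback a b T₂.o' T₁.o'
  P₃₂ : C
  c : P₃₂ ⟶ T₃.K'
  d : P₃₂ ⟶ T₂.K'
  pb₃₂ : IsPullback c d T₃.o' T₂.i'
  P : C
  e : P ⟶ P₃₂
  f : P ⟶ P₂₁
  pb : IsPullback e f d a

namespace Chain

variable {O₁ I₁ O₂ I₂ O₃ I₃ : C} {r₁ : LinearRule M O₁ I₁} {r₂ : LinearRule M O₂ I₂}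
  {r₃ : LinearRule M O₃ I₃}

/-- The chain of the reversed transformations. -/
def rev (F : Chain r₁ r₂ r₃) : Chain r₃.rev r₂.rev r₁.rev where
  X₁ := F.T₂.I'
  o₁ := F.i₃
  i₂ := F.T₂.a_star
  o₁_mem := F.i₃_mem
  i₂_mem := F.T₂.a_star_mem F.i₂_mem
  T₂ := F.T₂.rev
  i₃ := F.o₁
  i₃_mem := F.o₁_mem
  T₁ := F.T₃
  T₃ := F.T₁
  P₂₁ := F.P₃₂
  a := F.d
  b := F.c
  pb₂₁ := F.pb₃₂.flip
  P₃₂ := F.P₂₁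
  c := F.b
  d := F.a
  pb₃₂ := F.pb₂₁.flip
  P := F.P
  e := F.f
  f := F.e
  pb := F.pb.flip

theorem exists_pullbacks {X₁ : C} {o₁ : O₁ ⟶ X₁} {i₂ : I₂ ⟶ X₁}
    (T₂ : TransDiagram r₂.rev i₂) {i₃ : I₃ ⟶ T₂.I'} (T₁ : TransDiagram r₁ o₁)
    (T₃ : TransDiagram r₃.rev i₃) :
    ∃ (P₂₁ : C) (a : P₂₁ ⟶ T₂.K') (b : P₂₁ ⟶ T₁.K') (_ : IsPullback a b T₂.o' T₁.o')
      (P₃₂ : C) (c : P₃₂ ⟶ T₃.K') (d : P₃₂ ⟶ T₂.K') (_ : IsPullback c d T₃.o' T₂.i')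
      (P : C) (e : P ⟶ P₃₂) (f : P ⟶ P₂₁), IsPullback e f d a := by
  have := MAdhesive.hasPullback T₂.o' T₁.o' T₂.rule.left_mem
  have := MAdhesive.hasPullback T₃.o' T₂.i' T₃.rule.left_mem
  have h₁ := IsPullback.of_hasPullback T₂.o' T₁.o'
  have h₂ := IsPullback.of_hasPullback T₃.o' T₂.i'
  have := MAdhesive.hasPullback (pullback.snd T₃.o' T₂.i') (pullback.fst T₂.o' T₁.o')
    (MAdhesive.pullback_mem h₂.flip T₃.rule.left_mem)
  exact ⟨_, _, _, h₁, _, _, _, h₂, _, _, _, IsPullback.of_hasPullback _ _⟩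

/-- An embedding of a composition diagram of the first two rules into a chain. -/
structure Embedding (F : Chain r₁ r₂ r₃) {μ : MSpan M I₂ O₁} (D : CompositionData r₂ r₁ μ) where
  u : D.N ⟶ F.X₁
  u_mem : M u
  fac₂ : D.m₂ ≫ u = F.i₂
  fac₁ : D.m₁ ≫ u = F.o₁

namespace Embedding

variable {F : Chain r₁ r₂ r₃} {μ : MSpan M I₂ O₁} {D : CompositionData r₂ r₁ μ}

/-- The induced morphism from the output of the composite rule. -/
noncomputable def out (E : F.Embedding D) : D.upper.I' ⟶ F.T₂.I' :=
  D.upper.low F.T₂ E.u E.u_mem E.fac₂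

theorem out_mem (E : F.Embedding D) : M E.out := D.upper.low_mem _ _ _ _

theorem a_star_out (E : F.Embedding D) : D.upper.a_star ≫ E.out = F.T₂.a_star :=
  D.upper.a_star_low _ _ _ _

/-- The induced transport diagram over the composite rule. -/
noncomputable def trans (E : F.Embedding D) : TransDiagram D.rule E.out :=
  TransDiagram.comp D.pb (D.upper.factor F.T₂ E.u E.u_mem E.fac₂).rev
    (D.lower.factor F.T₁ E.u E.u_mem E.fac₁) F.pb₂₁

/-- The composition of the third rule with the composite of the first two that a chain gives. -/
noncomputable def outer (E : F.Embedding D) {μ' : MSpan M I₃ D.upper.I'}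
    (h : IsPushout μ'.left μ'.right F.i₃ E.out) : CompositionData r₃ D.rule μ' where
  N := F.T₂.I'
  m₂ := F.i₃
  m₁ := E.out
  po := h
  upper := F.T₃
  lower := E.trans
  K := F.P
  l₂ := F.e ≫ F.c
  l₁ := F.f
  pb := F.pb.paste_horiz F.pb₃₂

end Embedding

/-- Satisfaction of the conditions of all the rules by a morphism out of the initial object
of the chain. -/
def Sat (F : Chain r₁ r₂ r₃) (c₁ : Condition M I₁) (c₂ : Condition M I₂) (c₃ : Condition M I₃)
    {H : C} (m : F.T₁.I' ⟶ H) : Prop :=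
  c₁.Sat (F.T₁.a_star ≫ m) ∧ ((c₂.shift F.i₂).trans F.T₁.rule).Sat m ∧
    ((c₃.shift F.i₃).trans (MSpan.comp F.T₂.rule.rev F.T₁.rule F.pb₂₁)).Sat m

section

variable (hunion : HasMEffectiveUnions M) (hfin : IsMFinitary M)
include hunion hfin

theorem sat_outer_cond (c₁ : Condition M I₁) (c₂ : Condition M I₂) (c₃ : Condition M I₃)
    {F : Chain r₁ r₂ r₃} {μ : MSpan M I₂ O₁} {D : CompositionData r₂ r₁ μ}
    (E : F.Embedding D) {μ' : MSpan M I₃ D.upper.I'}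
    (h : IsPushout μ'.left μ'.right F.i₃ E.out) {H : C} {m : F.T₁.I' ⟶ H} (hm : M m) :
    ((E.outer h).cond c₃ (D.cond c₂ c₁)).Sat m ↔ F.Sat c₁ c₂ c₃ m := by
  refine Condition.sat_and.trans ?_
  rw [Chain.Sat, ← and_assoc, ← D.sat_cond hunion hfin c₂ c₁ F.T₁ E.u E.u_mem E.fac₁ E.fac₂ hm]
  exact and_congr_left' 
    (Condition.sat_shift hunion _ _ _ (D.lower.low_mem F.T₁ E.u E.u_mem E.fac₁) hm)

/-- When the last two rules are composed first, the third condition travels from X₂ to X₁ and then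
to X₀, whereas `Chain.Sat` moves it in one step. `Condition.trans_trans_equivalent` reconciles the
two. -/
theorem sat_trans_shift_cond_rev (c₂ : Condition M I₂) (c₃ : Condition M I₃)
    {F : Chain r₁ r₂ r₃} {μ : MSpan M I₃ O₂} {D : CompositionData r₃ r₂ μ}
    (E : F.rev.Embedding D.rev) {H : C} {m : F.T₁.I' ⟶ H} (hm : M m) :
    (((D.cond c₃ c₂).shift E.out).trans F.T₁.rule).Sat m ↔
      ((c₂.shift F.i₂).trans F.T₁.rule).Sat m ∧
        ((c₃.shift F.i₃).trans (MSpan.comp F.T₂.rule.rev F.T₁.rule F.pb₂₁)).Sat m := by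
  have h : ((D.cond c₃ c₂).shift E.out).Equivalent
      ((c₂.shift F.i₂).and ((c₃.shift F.i₃).trans F.T₂.rule.rev)) := by
    intro H p hp
    refine (Condition.sat_shift hunion _ _ _ E.out_mem hp).trans ?_
    refine Iff.trans ?_ (Condition.sat_and.trans
      (and_congr_left' (Condition.sat_shift hunion _ _ _ F.i₂_mem hp))).symm
    exact D.sat_cond (r₁ := r₂) hunion hfin c₃ c₂ F.T₂.rev E.u E.u_mem E.fac₂ E.fac₁ hp
  exact (h.trans hunion hfin _ _ _ hm).trans (Condition.sat_and_trans.trans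
    (and_congr_right' (Condition.trans_trans_equivalent hunion hfin _ F.pb₂₁ _ _ hm)))

theorem sat_outer_cond_rev (c₁ : Condition M I₁) (c₂ : Condition M I₂) (c₃ : Condition M I₃)
    {F : Chain r₁ r₂ r₃} {μ : MSpan M I₃ O₂} {D : CompositionData r₃ r₂ μ}
    (E : F.rev.Embedding D.rev) {μ' : MSpan M D.lower.I' O₁}
    (h : IsPushout μ'.rev.left μ'.rev.right F.o₁ E.out) {H : C} {m : F.T₁.I' ⟶ H} (hm : M m) :
    (CompositionData.cond (E.outer h).rev (D.cond c₃ c₂) c₁).Sat m ↔ F.Sat c₁ c₂ c₃ m := by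
  refine Condition.sat_and.trans ?_
  exact and_congr (Condition.sat_shift hunion _ _ _ (F.T₁.a_star_mem F.o₁_mem) hm)
    (sat_trans_shift_cond_rev hunion hfin c₂ c₃ E hm)

/-- If the conditions of the chain can be satisfied, so can that of the composite of the
last two rules. -/
theorem exists_sat_cond_rev (c₁ : Condition M I₁) (c₂ : Condition M I₂) (c₃ : Condition M I₃)
    {F : Chain r₁ r₂ r₃} {μ : MSpan M I₃ O₂} {D : CompositionData r₃ r₂ μ}
    (E : F.rev.Embedding D.rev) {H : C} {m : F.T₁.I' ⟶ H} (hm : M m) (h : F.Sat c₁ c₂ c₃ m) :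
    ∃ (H' : C) (m' : D.lower.I' ⟶ H'), M m' ∧ (D.cond c₃ c₂).Sat m' := by
  -- The witness `H'` is the output of the greatest transformation inside `H` by the reverse of
  -- `F.T₁.rule`.
  obtain ⟨T⟩ := MaxDerivation.nonempty hunion hfin F.T₁.rule hm
  have h' := (Condition.sat_trans_iff _ T).mp
    ((sat_trans_shift_cond_rev hunion hfin c₂ c₃ E hm).mpr h.2)
  have hT := T.out_mem hm
  exact ⟨_, E.out ≫ T.T.a_star, MAdhesive.comp_mem _ _ E.out_mem hT,
    (Condition.sat_shift hunion _ _ _ E.out_mem hT).mp h'⟩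

end

/-- Composition diagrams of both stages give rise to a chain. -/
theorem exists_embedding {μ : MSpan M I₂ O₁} (D : CompositionData r₂ r₁ μ)
    {μ' : MSpan M I₃ D.upper.I'} (D' : CompositionData r₃ D.rule μ') :
    ∃ (F : Chain r₁ r₂ r₃) (E : F.Embedding D), IsPushout μ'.left μ'.right F.i₃ E.out := by
  -- Splitting the second-stage transformation gives an object containing `D.N`, which serves as X₁;
  -- pasting below `D.upper` and `D.lower` turns the pieces into transformations by the original
  -- rules.
  obtain ⟨T₂, ⟨T₁⟩⟩ := TransDiagram.decomp D.pb D'.lower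
  let U : TransDiagram r₂.rev (D.m₂ ≫ T₂.a_star) := D.upper.paste T₂.rev
  let L : TransDiagram r₁ (D.m₁ ≫ T₂.a_star) := D.lower.paste T₁
  have hu : M T₂.a_star := T₂.a_star_mem D'.m₁_mem
  obtain ⟨P₂₁, a, b, pb₂₁, P₃₂, c, d, pb₃₂, P, e, f, pb⟩ := exists_pullbacks U L D'.upper
  let F : Chain r₁ r₂ r₃ := ⟨_, _, _, MAdhesive.comp_mem _ _ D.m₁_mem hu,
    MAdhesive.comp_mem _ _ D.m₂_mem hu, U, _, D'.m₂_mem, L, D'.upper, P₂₁, a, b, pb₂₁,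
    P₃₂, c, d, pb₃₂, P, e, f, pb⟩
  let E : F.Embedding D := ⟨T₂.a_star, hu, rfl, rfl⟩
  refine ⟨F, E, ?_⟩
  have h : E.out = D'.m₁ :=
    D.upper.low_eq U _ _ _ (w := T₂.k) T₂.po.w.symm rfl T₂.poc.w.symm
  rw [h]
  exact D'.po

end Chain

/-! ### Recovering spans from chains; isomorphism and minimality of chains -/

omit [MAdhesive M] in
theorem MSpan.Equiv.of_isPullback {A B X : C} {s t : MSpan M A B} {i : A ⟶ X} {o : B ⟶ X}
    (hs : IsPullback s.left s.right i o) (ht : IsPullback t.left t.right i o) : s.Equiv t :=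
  ⟨hs.isoIsPullback _ _ ht, hs.isoIsPullback_hom_fst _ _ ht, hs.isoIsPullback_hom_snd _ _ ht⟩

omit [MAdhesive M] in
theorem MSpan.Equiv.isPullback {A B X : C} {s t : MSpan M A B} (h : s.Equiv t) {i : A ⟶ X}
    {o : B ⟶ X} (ht : IsPullback t.left t.right i o) : IsPullback s.left s.right i o := by
  obtain ⟨φ, h₁, h₂⟩ := h
  exact IsPullback.of_iso ht φ.symm (Iso.refl _) (Iso.refl _) (Iso.refl _) (by simp [← h₁])
    (by simp [← h₂]) (by simp) (by simp)

omit [MAdhesive M] in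
theorem MSpan.Equiv.isPushout {A B X : C} {s t : MSpan M A B} (h : s.Equiv t) {i : A ⟶ X}
    {o : B ⟶ X} (ht : IsPushout t.left t.right i o) : IsPushout s.left s.right i o := by
  obtain ⟨φ, h₁, h₂⟩ := h
  exact IsPushout.of_iso ht φ.symm (Iso.refl _) (Iso.refl _) (Iso.refl _) (by simp [← h₁])
    (by simp [← h₂]) (by simp) (by simp)

theorem MAdhesive.exists_span {A B X : C} {i : A ⟶ X} {o : B ⟶ X} (hi : M i) (ho : M o) :
    ∃ s : MSpan M A B, IsPullback s.left s.right i o := by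
  have := MAdhesive.hasPullback i o hi
  have h := IsPullback.of_hasPullback i o
  exact ⟨⟨_, _, _, MAdhesive.pullback_mem h ho, MAdhesive.pullback_mem h.flip hi⟩, h⟩

omit [MAdhesive M] in
/-- Pullback squares remain so after composition with a monomorphism. -/
theorem isPullback_comp_mono {A B D E X : C} {f : A ⟶ B} {g : A ⟶ D} {h : B ⟶ E} {k : D ⟶ E}
    (H : IsPullback f g h k) (u : E ⟶ X) [Mono u] : IsPullback f g (h ≫ u) (k ≫ u) := by
  refine IsPullback.of_isLimit' ⟨by rw [← Category.assoc, H.w, Category.assoc]⟩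
    (PullbackCone.IsLimit.mk _ (fun s => H.lift s.fst s.snd ?_) ?_ ?_ ?_)
  · have := s.condition
    simpa only [← Category.assoc, cancel_mono] using this
  · intro s; simp
  · intro s; simp
  · intro s t ht₁ ht₂
    apply H.hom_ext <;> simp [ht₁, ht₂]

namespace Chain

variable {O₁ I₁ O₂ I₂ O₃ I₃ : C} {r₁ : LinearRule M O₁ I₁} {r₂ : LinearRule M O₂ I₂}
  {r₃ : LinearRule M O₃ I₃}

/-- The overlap is thus determined up to isomorphism by the chain. -/
theorem Embedding.isPullback {F : Chain r₁ r₂ r₃} {μ : MSpan M I₂ O₁}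
    {D : CompositionData r₂ r₁ μ} (E : F.Embedding D) :
    IsPullback μ.left μ.right F.i₂ F.o₁ := by
  have := MAdhesive.mono_of_mem _ E.u_mem
  rw [← E.fac₂, ← E.fac₁]
  exact isPullback_comp_mono (MAdhesive.isPullback_of_isPushout D.po μ.left_mem) E.u

omit [MAdhesive M] in
theorem Embedding.subsingleton (F : Chain r₁ r₂ r₃) {μ : MSpan M I₂ O₁}
    (D : CompositionData r₂ r₁ μ) : Subsingleton (F.Embedding D) := by
  constructor
  rintro ⟨u, hu, h₂, h₁⟩ ⟨u', hu', h₂', h₁'⟩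
  obtain rfl : u = u' := D.po.hom_ext (by rw [h₂, h₂']) (by rw [h₁, h₁'])
  rfl

theorem Embedding.nonempty (hunion : HasMEffectiveUnions M) (F : Chain r₁ r₂ r₃)
    {μ : MSpan M I₂ O₁} (D : CompositionData r₂ r₁ μ)
    (h : IsPullback μ.left μ.right F.i₂ F.o₁) : Nonempty (F.Embedding D) := by
  have e₂ := D.po.inl_desc F.i₂ F.o₁ h.w
  have e₁ := D.po.inr_desc F.i₂ F.o₁ h.w
  exact ⟨⟨D.po.desc F.i₂ F.o₁ h.w, hunion _ _ _ _ _ _ _ μ.left_mem μ.right_mem D.m₂_mem D.m₁_mem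
    F.i₂_mem F.o₁_mem D.po h e₂ e₁, e₂, e₁⟩⟩

/-- The pushout of the overlap is the union of `I₂` and `O₁` in X₁, and `F.T₂` and `F.T₁` restrict
to it. -/
theorem exists_compositionData (hunion : HasMEffectiveUnions M) (F : Chain r₁ r₂ r₃)
    {μ : MSpan M I₂ O₁} (h : IsPullback μ.left μ.right F.i₂ F.o₁) :
    Nonempty (CompositionData r₂ r₁ μ) := by
  have := MAdhesive.hasPushout μ.left μ.right μ.left_mem
  have hN := IsPushout.of_hasPushout μ.left μ.right
  have e₂ := hN.inl_desc F.i₂ F.o₁ h.w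
  have e₁ := hN.inr_desc F.i₂ F.o₁ h.w
  have hu : M (hN.desc F.i₂ F.o₁ h.w) := hunion _ _ _ _ _ _ _ μ.left_mem μ.right_mem
    (MAdhesive.pushout_mem hN.flip μ.right_mem) (MAdhesive.pushout_mem hN μ.left_mem)
    F.i₂_mem F.o₁_mem hN h e₂ e₁
  obtain ⟨U⟩ := F.T₂.restrict _ hu e₂
  obtain ⟨L⟩ := F.T₁.restrict _ hu e₁
  have := MAdhesive.hasPullback U.o' L.o' U.rule.left_mem
  exact ⟨⟨_, _, _, hN, U, L, _, _, _, IsPullback.of_hasPullback _ _⟩⟩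

/-- The chain arises from composition diagrams of both stages along the given spans. -/
def Compat (F : Chain r₁ r₂ r₃) {μ : MSpan M I₂ O₁} (D : CompositionData r₂ r₁ μ)
    (μ' : MSpan M I₃ D.upper.I') : Prop :=
  ∃ E : F.Embedding D, IsPushout μ'.left μ'.right F.i₃ E.out

theorem Compat.equiv_fst {F : Chain r₁ r₂ r₃} {μ ν : MSpan M I₂ O₁} {D : CompositionData r₂ r₁ μ}
    {D' : CompositionData r₂ r₁ ν} {μ' : MSpan M I₃ D.upper.I'} {ν' : MSpan M I₃ D'.upper.I'}
    (h : F.Compat D μ') (h' : F.Compat D' ν') : μ.Equiv ν :=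
  MSpan.Equiv.of_isPullback h.choose.isPullback h'.choose.isPullback

theorem Compat.equiv_snd {F : Chain r₁ r₂ r₃} {μ : MSpan M I₂ O₁} {D : CompositionData r₂ r₁ μ}
    {μ' ν' : MSpan M I₃ D.upper.I'} (h : F.Compat D μ') (h' : F.Compat D ν') : μ'.Equiv ν' := by
  obtain ⟨E, h⟩ := h
  obtain ⟨E', h'⟩ := h'
  obtain rfl := (Embedding.subsingleton F D).elim E E'
  exact MSpan.Equiv.of_isPullback (MAdhesive.isPullback_of_isPushout h μ'.left_mem)
    (MAdhesive.isPullback_of_isPushout h' ν'.left_mem)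

/-- Isomorphism of the middle parts of chains. -/
def Equiv (F F' : Chain r₁ r₂ r₃) : Prop :=
  ∃ (θ : F.X₁ ⟶ F'.X₁) (_ : IsIso θ) (hM : M θ) (h₂ : F.i₂ ≫ θ = F'.i₂),
    F.o₁ ≫ θ = F'.o₁ ∧ F.i₃ ≫ F.T₂.low F'.T₂ θ hM h₂ = F'.i₃

theorem Equiv.rev {F F' : Chain r₁ r₂ r₃} (h : F.Equiv F') : F.rev.Equiv F'.rev := by
  obtain ⟨θ, _, hM, h₂, h₁, h₃⟩ := h
  refine ⟨F.T₂.low F'.T₂ θ hM h₂, F.T₂.isIso_low _ _ _ _, F.T₂.low_mem _ _ _ _,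
    F.T₂.a_star_low _ _ _ _, h₃, ?_⟩
  exact (congrArg (F.o₁ ≫ ·) (F.T₂.low_rev F'.T₂ θ hM h₂)).trans h₁

/-- `Compat` involves only X₁, `T₂` and the three matches, so an isomorphism of middle parts
suffices to transfer it. -/
theorem Compat.of_equiv {F F' : Chain r₁ r₂ r₃} (h : F.Equiv F') {μ : MSpan M I₂ O₁}
    {D : CompositionData r₂ r₁ μ} {μ' : MSpan M I₃ D.upper.I'} (hF : F.Compat D μ') :
    F'.Compat D μ' := by
  obtain ⟨θ, _, hM, h₂, h₁, h₃⟩ := h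
  obtain ⟨E, hE⟩ := hF
  let E' : F'.Embedding D := ⟨E.u ≫ θ, MAdhesive.comp_mem _ _ E.u_mem hM,
    by rw [← Category.assoc, E.fac₂, h₂], by rw [← Category.assoc, E.fac₁, h₁]⟩
  have hE' : E.out ≫ F.T₂.low F'.T₂ θ hM h₂ = E'.out :=
    D.upper.low_comp F.T₂ E.u E.u_mem E.fac₂ F'.T₂ θ hM h₂ _ _ E'.fac₂ rfl
  have := F.T₂.isIso_low F'.T₂ θ hM h₂
  exact ⟨E', hE.of_iso (Iso.refl _) (Iso.refl _) (Iso.refl _) (asIso (F.T₂.low F'.T₂ θ hM h₂))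
    (by simp) (by simp) (by simpa) (by simpa)⟩

/-- The given spans fix X₂ as a pushout. Then X₁ is recovered from X₂ by undoing the middle
transformation, relative to the one that `D` contains. -/
theorem Compat.equiv {F F' : Chain r₁ r₂ r₃} {μ : MSpan M I₂ O₁}
    {D : CompositionData r₂ r₁ μ} {μ' : MSpan M I₃ D.upper.I'} (h : F.Compat D μ')
    (h' : F'.Compat D μ') : F.Equiv F' := by
  obtain ⟨E, h⟩ := h
  obtain ⟨E', h'⟩ := h'
  let θ₂ : F.T₂.I' ≅ F'.T₂.I' := h.isoIsPushout _ _ h'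
  have hi : F.i₃ ≫ θ₂.hom = F'.i₃ := h.inl_isoIsPushout_hom _ _ h'
  have ho : E.out ≫ θ₂.hom = E'.out := h.inr_isoIsPushout_hom _ _ h'
  have hθ₂ : M θ₂.hom := MAdhesive.mem_of_isIso _ θ₂.isIso_hom
  let G := (D.upper.factor F.T₂ E.u E.u_mem E.fac₂).rev
  let G' := (D.upper.factor F'.T₂ E'.u E'.u_mem E'.fac₂).rev
  let θ : F.X₁ ⟶ F'.X₁ := G.low G' θ₂.hom hθ₂ ho
  have hθ : M θ := G.low_mem G' θ₂.hom hθ₂ ho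
  have hu : E.u ≫ θ = E'.u := G.a_star_low G' θ₂.hom hθ₂ ho
  have h₂ : F.i₂ ≫ θ = F'.i₂ := by rw [← E.fac₂, Category.assoc, hu, E'.fac₂]
  refine ⟨θ, G.isIso_low G' θ₂.hom hθ₂ ho (iso := θ₂.isIso_hom), hθ, h₂,
    by rw [← E.fac₁, Category.assoc, hu, E'.fac₁], ?_⟩
  have hl : F.T₂.low F'.T₂ θ hθ h₂ = θ₂.hom := by
    refine F.T₂.low_eq F'.T₂ θ hθ h₂ (w := G.mid G' θ₂.hom hθ₂ ho)
      (G.isPushout_low G' θ₂.hom hθ₂ ho).w.symm ?_ (G.isPushout_mid G' θ₂.hom hθ₂ ho).w.symm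
    rw [← E.a_star_out, Category.assoc, ho, E'.a_star_out]
  rw [hl, hi]

/-- A chain is minimal if it does not restrict to a smaller chain. -/
def IsMinimal (F : Chain r₁ r₂ r₃) : Prop :=
  ∀ ⦃Y : C⦄ (y : Y ⟶ F.X₁) (hy : M y) (i : I₂ ⟶ Y) (hi : i ≫ y = F.i₂) (o : O₁ ⟶ Y),
    o ≫ y = F.o₁ → ∀ (S : TransDiagram r₂.rev i) (t : I₃ ⟶ S.I'),
      t ≫ S.low F.T₂ y hy hi = F.i₃ → IsIso y

theorem IsMinimal.rev {F : Chain r₁ r₂ r₃} (h : F.IsMinimal) : F.rev.IsMinimal := by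
  intro Y y hy i hi o ho S t ht
  have : IsIso (S.low F.T₂.rev y hy hi) :=
    h _ (S.low_mem _ _ _ _) S.a_star (S.a_star_low F.T₂.rev y hy hi) t ht S.rev o
      ((congrArg (o ≫ ·) (S.low_rev F.T₂.rev y hy hi)).trans ho)
  exact S.isIso_of_isIso_low F.T₂.rev y hy hi

/-- A smaller chain on `Y` receives `D.N`, so its transform receives both `I₃` and the output of the
composite rule. As X₂ is the pushout of these, the inclusion of the transform into X₂ is a split
epimorphism as well as monic, hence invertible; so is `y`. -/
theorem Compat.isMinimal {F : Chain r₁ r₂ r₃} {μ : MSpan M I₂ O₁}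
    {D : CompositionData r₂ r₁ μ} {μ' : MSpan M I₃ D.upper.I'} (h : F.Compat D μ') :
    F.IsMinimal := by
  obtain ⟨E, h⟩ := h
  intro Y y hy i hi o ho S t ht
  have := MAdhesive.mono_of_mem y hy
  have e : μ.left ≫ i = μ.right ≫ o := by
    rw [← cancel_mono y, Category.assoc, Category.assoc, hi, ho, E.isPullback.w]
  let s := D.po.desc i o e
  have hs : D.m₂ ≫ s = i := D.po.inl_desc i o e
  have hsy : s ≫ y = E.u := by
    apply D.po.hom_ext
    · rw [← Category.assoc, D.po.inl_desc, hi, E.fac₂]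
    · rw [← Category.assoc, D.po.inr_desc, ho, E.fac₁]
  have hsM : M s := MAdhesive.decomp_mem s y (by rw [hsy]; exact E.u_mem) hy
  have hl : D.upper.low S s hsM hs ≫ S.low F.T₂ y hy hi = E.out :=
    D.upper.low_comp S s hsM hs F.T₂ y hy hi E.u E.u_mem E.fac₂ hsy
  have := MAdhesive.mono_of_mem _ (S.low_mem F.T₂ y hy hi)
  have e' : μ'.left ≫ t = μ'.right ≫ D.upper.low S s hsM hs := by
    rw [← cancel_mono (S.low F.T₂ y hy hi), Category.assoc, Category.assoc, ht, hl, h.w]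
  have hsplit : h.desc t _ e' ≫ S.low F.T₂ y hy hi = 𝟙 _ := by
    apply h.hom_ext
    · rw [← Category.assoc, h.inl_desc, ht, Category.comp_id]
    · rw [← Category.assoc, h.inr_desc, hl, Category.comp_id]
  have : IsSplitEpi (S.low F.T₂ y hy hi) := ⟨⟨⟨_, hsplit⟩⟩⟩
  have : IsIso (S.low F.T₂ y hy hi) := isIso_of_mono_of_isSplitEpi _
  exact S.isIso_of_isIso_low F.T₂ y hy hi

/-- The union of `I₃` and `E.out` in X₂ carries a restriction of the middle transformation, hence a
smaller chain. Minimality forces the union to be all of X₂. -/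
theorem IsMinimal.isPushout (hunion : HasMEffectiveUnions M) {F : Chain r₁ r₂ r₃}
    (h : F.IsMinimal) {μ : MSpan M I₂ O₁} {D : CompositionData r₂ r₁ μ} (E : F.Embedding D)
    {μ' : MSpan M I₃ D.upper.I'} (hμ' : IsPullback μ'.left μ'.right F.i₃ E.out) :
    IsPushout μ'.left μ'.right F.i₃ E.out := by
  have := MAdhesive.hasPushout μ'.left μ'.right μ'.left_mem
  have hN := IsPushout.of_hasPushout μ'.left μ'.right
  set inl := pushout.inl μ'.left μ'.right
  set inr := pushout.inr μ'.left μ'.right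
  have e₂ := hN.inl_desc F.i₃ E.out hμ'.w
  have e₁ := hN.inr_desc F.i₃ E.out hμ'.w
  set y := hN.desc F.i₃ E.out hμ'.w
  have hinr : M inr := MAdhesive.pushout_mem hN μ'.left_mem
  have hy : M y := hunion _ _ _ _ _ _ _ μ'.left_mem μ'.right_mem
    (MAdhesive.pushout_mem hN.flip μ'.right_mem) hinr F.i₃_mem E.out_mem hN hμ' e₂ e₁
  have hi : (D.upper.a_star ≫ inr) ≫ y = F.T₂.a_star := by
    rw [Category.assoc, e₁, E.a_star_out]
  obtain ⟨S⟩ := TransDiagram.restrict (r := r₂) F.T₂.rev y hy hi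
  have hrev : D.upper.rev.low F.T₂.rev E.out E.out_mem E.a_star_out = E.u :=
    D.upper.low_rev F.T₂ E.u E.u_mem E.fac₂
  have hl : D.upper.rev.low (r := r₂) S inr hinr rfl ≫ S.low (r := r₂) F.T₂.rev y hy hi = E.u :=
    (D.upper.rev.low_comp (r := r₂) S inr hinr rfl F.T₂.rev y hy hi E.out E.out_mem
      E.a_star_out e₁).trans hrev
  have : IsIso (S.low (r := r₂) F.T₂.rev y hy hi) := by
    refine h _ (S.low_mem (r := r₂) F.T₂.rev y hy hi) S.a_star
      (S.a_star_low (r := r₂) F.T₂.rev y hy hi)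
      (D.m₁ ≫ D.upper.rev.low (r := r₂) S inr hinr rfl) ?_ S.rev inl ?_
    · exact (Category.assoc _ _ _).trans ((congrArg (D.m₁ ≫ ·) hl).trans E.fac₁)
    · exact (congrArg (inl ≫ ·) (S.low_rev (r := r₂) F.T₂.rev y hy hi)).trans e₂
  have : IsIso y := S.isIso_of_isIso_low (r := r₂) F.T₂.rev y hy hi
  exact hN.of_iso (Iso.refl _) (Iso.refl _) (Iso.refl _) (asIso y) (by simp) (by simp)
    (by simpa) (by simpa)

end Chain

/-! ## Isomorphisms of linear rules -/

namespace LinearRule.Iso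

variable {O I O' I' O'' I'' : C} {r : LinearRule M O I} {r' : LinearRule M O' I'}
  {r'' : LinearRule M O'' I''}

omit [MAdhesive M] in
/-- The inverse isomorphism. -/
def symm (e : LinearRule.Iso r r') : LinearRule.Iso r' r where
  ω := e.ω.symm
  κ := e.κ.symm
  ι := e.ι.symm
  left_comm := by
    change e.κ.inv ≫ r.left = r'.left ≫ e.ω.inv
    rw [CategoryTheory.Iso.inv_comp_eq, ← Category.assoc, e.left_comm]; simp
  right_comm := by
    change e.κ.inv ≫ r.right = r'.right ≫ e.ι.inv
    rw [CategoryTheory.Iso.inv_comp_eq, ← Category.assoc, e.right_comm]; simp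

omit [MAdhesive M] in
/-- The composite isomorphism. -/
def trans (e : LinearRule.Iso r r') (e' : LinearRule.Iso r' r'') : LinearRule.Iso r r'' where
  ω := e.ω ≪≫ e'.ω
  κ := e.κ ≪≫ e'.κ
  ι := e.ι ≪≫ e'.ι
  left_comm := by
    simp [e'.left_comm, reassoc_of% e.left_comm]
  right_comm := by
    simp [e'.right_comm, reassoc_of% e.right_comm]

end LinearRule.Iso

/-! ## Matches -/

namespace Match

variable {R₂ R₁ : RuleAC M}

/-- The span chosen to represent a match. -/
noncomputable def span (q : Match R₂ R₁) : MSpan M R₂.I R₁.O := (Quotient.out q).1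

/-- The composition diagram chosen for a match. -/
noncomputable def diagram (q : Match R₂ R₁) : CompDiagram R₂ R₁ q.span :=
  (Quotient.out q).2.choose

theorem ext {q q' : Match R₂ R₁} (h : q.span.Equiv q'.span) : q = q' := by
  rw [← Quotient.out_eq q, ← Quotient.out_eq q']
  exact Quotient.sound h

theorem exists_sat (q : Match R₂ R₁) :
    ∃ (H : C) (m : (comp R₂ R₁ q).I ⟶ H), M m ∧ (comp R₂ R₁ q).cond.Sat m := by
  by_contra! h
  exact (Quotient.out q).2.choose_spec fun H m hm => iff_of_false (h H m hm) fun h => h trivial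

theorem exists_of_sat {μ : MSpan M R₂.I R₁.O} (D : CompositionData R₂.rule R₁.rule μ)
    {H : C} {m : D.lower.I' ⟶ H} (hm : M m) (h : (D.cond R₂.cond R₁.cond).Sat m) :
    ∃ q : Match R₂ R₁, q.span.Equiv μ := by
  have hμ : IsAdmissible R₂ R₁ μ := ⟨D.diagram, fun he => ((he H m hm).mp h) trivial⟩
  let q : Match R₂ R₁ := Quotient.mk (admissibleSetoid R₂ R₁) ⟨μ, hμ⟩
  exact ⟨q, Quotient.exact (Quotient.out_eq q)⟩

end Match

/-! ### Correspondence between minimal satisfiable chains and pairs of matches -/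

section Associativity

variable (R₁ R₂ R₃ : RuleAC M)

/-- Pairs of matches that compose the first two rules first. -/
abbrev LeftMatch := Σ μ₂₁ : Match R₂ R₁, Match R₃ (comp R₂ R₁ μ₂₁)

/-- Pairs of matches that compose the last two rules first. -/
abbrev RightMatch := Σ μ₃₂ : Match R₃ R₂, Match (comp R₃ R₂ μ₃₂) R₁

variable {R₁ R₂ R₃}

/-- The chain arises from the pair of matches. -/
def Chain.OfLeft (F : Chain R₁.rule R₂.rule R₃.rule) (x : LeftMatch R₁ R₂ R₃) : Prop :=
  F.Compat x.1.diagram.data x.2.span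

/-- The chain arises from the pair of matches. -/
def Chain.OfRight (F : Chain R₁.rule R₂.rule R₃.rule) (y : RightMatch R₁ R₂ R₃) : Prop :=
  F.rev.Compat y.1.diagram.data.rev y.2.span.rev

/-- All conditions of the rules are simultaneously satisfiable along the chain. -/
def Chain.Satisfiable (F : Chain R₁.rule R₂.rule R₃.rule) : Prop :=
  ∃ (H : C) (m : F.T₁.I' ⟶ H), M m ∧ F.Sat R₁.cond R₂.cond R₃.cond m

variable (hunion : HasMEffectiveUnions M) (hfin : IsMFinitary M)

namespace Chain

variable {F : Chain R₁.rule R₂.rule R₃.rule}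

theorem OfLeft.unique {x x' : LeftMatch R₁ R₂ R₃} (h : F.OfLeft x) (h' : F.OfLeft x') :
    x = x' := by
  obtain ⟨q, p⟩ := x
  obtain ⟨q', p'⟩ := x'
  obtain rfl : q = q' := Match.ext (h.equiv_fst h')
  obtain rfl : p = p' := Match.ext (h.equiv_snd h')
  rfl

theorem OfRight.unique {y y' : RightMatch R₁ R₂ R₃} (h : F.OfRight y) (h' : F.OfRight y') :
    y = y' := by
  obtain ⟨q, p⟩ := y
  obtain ⟨q', p'⟩ := y'
  obtain rfl : q = q' := Match.ext <| by
    obtain ⟨φ, h₁, h₂⟩ := h.equiv_fst h'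
    exact ⟨φ, h₂, h₁⟩
  obtain rfl : p = p' := Match.ext <| by
    obtain ⟨φ, h₁, h₂⟩ := h.equiv_snd h'
    exact ⟨φ, h₂, h₁⟩
  rfl

include hunion hfin

/-- The linear rule of a chain together with its conditions is the iterated composite. -/
theorem OfLeft.exists_iso {x : LeftMatch R₁ R₂ R₃} (h : F.OfLeft x) :
    ∃ e : LinearRule.Iso (comp R₃ (comp R₂ R₁ x.1) x.2).rule
        (MSpan.comp (MSpan.comp F.T₃.rule.rev F.T₂.rule.rev F.pb₃₂) F.T₁.rule
          (F.pb.flip.paste_horiz F.pb₂₁.flip).flip),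
      ∀ (H : C) (m : (comp R₃ (comp R₂ R₁ x.1) x.2).I ⟶ H), M m →
        ((comp R₃ (comp R₂ R₁ x.1) x.2).cond.Sat m ↔
          F.Sat R₁.cond R₂.cond R₃.cond (e.ι.inv ≫ m)) := by
  obtain ⟨E, h⟩ := h
  let D : CompositionData R₃.rule (comp R₂ R₁ x.1).rule x.2.span := x.2.diagram.data
  obtain ⟨e, he⟩ := CompositionData.exists_iso hunion hfin D (E.outer h)
  refine ⟨⟨e.ω, e.κ, e.ι, ?_, ?_⟩, fun H m hm => (he _ _ H m hm).trans ?_⟩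
  · exact (congrArg (e.κ.hom ≫ ·) (Category.assoc _ _ _).symm).trans e.left_comm
  · exact (congrArg (e.κ.hom ≫ ·) (Category.assoc _ _ _)).trans e.right_comm
  · exact sat_outer_cond hunion hfin R₁.cond R₂.cond R₃.cond E h
      (MAdhesive.comp_mem _ _ (MAdhesive.mem_of_isIso _ e.ι.isIso_inv) hm)

/-- The target span and the predicate are those of `OfLeft.exists_iso`, so the two isomorphisms can
be composed. -/
theorem OfRight.exists_iso {y : RightMatch R₁ R₂ R₃} (h : F.OfRight y) :
    ∃ e : LinearRule.Iso (comp (comp R₃ R₂ y.1) R₁ y.2).rule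
        (MSpan.comp (MSpan.comp F.T₃.rule.rev F.T₂.rule.rev F.pb₃₂) F.T₁.rule
          (F.pb.flip.paste_horiz F.pb₂₁.flip).flip),
      ∀ (H : C) (m : (comp (comp R₃ R₂ y.1) R₁ y.2).I ⟶ H), M m →
        ((comp (comp R₃ R₂ y.1) R₁ y.2).cond.Sat m ↔
          F.Sat R₁.cond R₂.cond R₃.cond (e.ι.inv ≫ m)) := by
  obtain ⟨E, h⟩ := h
  let D : CompositionData (comp R₃ R₂ y.1).rule R₁.rule y.2.span := y.2.diagram.data
  obtain ⟨e, he⟩ := CompositionData.exists_iso hunion hfin D (E.outer h).rev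
  refine ⟨e, fun H m hm => (he _ _ H m hm).trans ?_⟩
  exact sat_outer_cond_rev hunion hfin R₁.cond R₂.cond R₃.cond E h
    (MAdhesive.comp_mem _ _ (MAdhesive.mem_of_isIso _ e.ι.isIso_inv) hm)

theorem OfLeft.satisfiable {x : LeftMatch R₁ R₂ R₃} (h : F.OfLeft x) : F.Satisfiable := by
  obtain ⟨e, he⟩ := h.exists_iso hunion hfin
  obtain ⟨H, m, hm, hs⟩ := x.2.exists_sat
  exact ⟨H, e.ι.inv ≫ m, MAdhesive.comp_mem _ _ (MAdhesive.mem_of_isIso _ e.ι.isIso_inv) hm,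
    (he H m hm).mp hs⟩

theorem OfRight.satisfiable {y : RightMatch R₁ R₂ R₃} (h : F.OfRight y) : F.Satisfiable := by
  obtain ⟨e, he⟩ := h.exists_iso hunion hfin
  obtain ⟨H, m, hm, hs⟩ := y.2.exists_sat
  exact ⟨H, e.ι.inv ≫ m, MAdhesive.comp_mem _ _ (MAdhesive.mem_of_isIso _ e.ι.isIso_inv) hm,
    (he H m hm).mp hs⟩

theorem exists_ofLeft (hF : F.IsMinimal) (hs : F.Satisfiable) :
    ∃ x : LeftMatch R₁ R₂ R₃, F.OfLeft x := by
  obtain ⟨H, m, hm, hs⟩ := hs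
  obtain ⟨μ, hμ⟩ := MAdhesive.exists_span F.i₂_mem F.o₁_mem
  obtain ⟨D⟩ := F.exists_compositionData hunion hμ
  obtain ⟨E⟩ := Embedding.nonempty hunion F D hμ
  obtain ⟨q, hq⟩ := Match.exists_of_sat (R₂ := R₂) (R₁ := R₁) D
    (MAdhesive.comp_mem _ _ (D.lower.low_mem F.T₁ E.u E.u_mem E.fac₁) hm)
    ((D.sat_cond hunion hfin R₂.cond R₁.cond F.T₁ E.u E.u_mem E.fac₁ E.fac₂ hm).mpr
      ⟨hs.1, hs.2.1⟩)
  -- The match `q` comes with its own chosen span and diagram, so the embedding is rebuilt for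
  -- these.
  obtain ⟨E⟩ := Embedding.nonempty hunion F q.diagram.data (hq.isPullback hμ)
  obtain ⟨ν, hν⟩ := MAdhesive.exists_span F.i₃_mem E.out_mem
  have hν' := hF.isPushout hunion E hν
  obtain ⟨p, hp⟩ := Match.exists_of_sat (R₂ := R₃) (R₁ := comp R₂ R₁ q) (E.outer hν') hm
    ((sat_outer_cond hunion hfin R₁.cond R₂.cond R₃.cond E hν' hm).mpr hs)
  exact ⟨⟨q, p⟩, E, hp.isPushout hν'⟩

theorem exists_ofRight (hF : F.IsMinimal) (hs : F.Satisfiable) :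
    ∃ y : RightMatch R₁ R₂ R₃, F.OfRight y := by
  obtain ⟨H, m, hm, hs⟩ := hs
  obtain ⟨μ, hμ⟩ := MAdhesive.exists_span F.rev.i₂_mem F.rev.o₁_mem
  obtain ⟨D'⟩ := F.rev.exists_compositionData hunion hμ
  let D : CompositionData R₃.rule R₂.rule μ.rev := D'.rev
  obtain ⟨E⟩ := Embedding.nonempty hunion F.rev D.rev hμ
  -- Admissibility of the inner match needs a morphism out of the input of the composite of the last
  -- two rules, not out of X₀.
  obtain ⟨H', m', hm', hs'⟩ :=
    exists_sat_cond_rev hunion hfin R₁.cond R₂.cond R₃.cond E hm hs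
  obtain ⟨q, hq⟩ := Match.exists_of_sat (R₂ := R₃) (R₁ := R₂) D hm' hs'
  have hq' : IsPullback q.span.rev.left q.span.rev.right F.rev.i₂ F.rev.o₁ :=
    (hq.isPullback hμ.flip).flip
  obtain ⟨E⟩ := Embedding.nonempty hunion F.rev q.diagram.data.rev hq'
  obtain ⟨ν, hν⟩ := MAdhesive.exists_span F.rev.i₃_mem E.out_mem
  have hν' := hF.rev.isPushout hunion E hν
  obtain ⟨p, hp⟩ := Match.exists_of_sat (R₂ := comp R₃ R₂ q) (R₁ := R₁) (E.outer hν').rev hm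
    ((sat_outer_cond_rev hunion hfin R₁.cond R₂.cond R₃.cond (μ' := ν.rev) E hν' hm).mpr hs)
  exact ⟨⟨q, p⟩, E, (hp.isPushout hν'.flip).flip⟩

omit hunion hfin in
theorem OfLeft.exists_chain (x : LeftMatch R₁ R₂ R₃) :
    ∃ F : Chain R₁.rule R₂.rule R₃.rule, F.OfLeft x :=
  exists_embedding (r₃ := R₃.rule) x.1.diagram.data x.2.diagram.data

omit hunion hfin in
theorem OfRight.exists_chain (y : RightMatch R₁ R₂ R₃) :
    ∃ F : Chain R₁.rule R₂.rule R₃.rule, F.OfRight y := by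
  obtain ⟨F, h⟩ := exists_embedding (r₃ := R₁.rule.rev) y.1.diagram.data.rev y.2.diagram.data.rev
  exact ⟨F.rev, h⟩

omit hunion hfin in
theorem OfRight.isMinimal {y : RightMatch R₁ R₂ R₃} (h : F.OfRight y) : F.IsMinimal :=
  (Compat.isMinimal h).rev

/-- Chains arising from the same `x` have isomorphic middle parts, so a second candidate `y'` also
arises from `F`, and a chain determines its pair of matches. -/
theorem existsUnique_right (x : LeftMatch R₁ R₂ R₃) :
    ∃! y : RightMatch R₁ R₂ R₃, ∃ F : Chain R₁.rule R₂.rule R₃.rule, F.OfLeft x ∧ F.OfRight y := by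
  obtain ⟨F, hF⟩ := OfLeft.exists_chain x
  obtain ⟨y, hy⟩ := exists_ofRight hunion hfin (Compat.isMinimal hF) (hF.satisfiable hunion hfin)
  refine ⟨y, ⟨F, hF, hy⟩, ?_⟩
  rintro y' ⟨F', hF', hy'⟩
  exact OfRight.unique (F := F) (Compat.of_equiv (Compat.equiv hF' hF).rev hy') hy

theorem existsUnique_left (y : RightMatch R₁ R₂ R₃) :
    ∃! x : LeftMatch R₁ R₂ R₃, ∃ F : Chain R₁.rule R₂.rule R₃.rule, F.OfLeft x ∧ F.OfRight y := by
  obtain ⟨F, hF⟩ := OfRight.exists_chain y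
  obtain ⟨x, hx⟩ := exists_ofLeft hunion hfin hF.isMinimal (hF.satisfiable hunion hfin)
  refine ⟨x, ⟨F, hx, hF⟩, ?_⟩
  rintro x' ⟨F', hx', hF'⟩
  exact OfLeft.unique (F := F) (Compat.of_equiv (Compat.equiv hF' hF).rev hx') hx

end Chain

end Associativity

/-- A relation that is a bijective correspondence gives an equivalence. -/
theorem exists_equiv_of_existsUnique {α β : Type*} (r : α → β → Prop) (h : ∀ a, ∃! b, r a b)
    (h' : ∀ b, ∃! a, r a b) : ∃ φ : α ≃ β, ∀ a, r a (φ a) := by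
  choose f hf hf' using h
  choose g hg hg' using h'
  exact ⟨⟨f, g, fun a => (hg' _ _ (hf a)).symm, fun b => (hf' _ _ (hg b)).symm⟩, hf⟩

end DPORewriting

theorem mainTheorem1 {C : Type u} [Category.{v} C] (M : MorphismProperty C)
    [DPORewriting.MAdhesive M] [Balanced C]
    (hfact : DPORewriting.HasEpiMFactorization M)
    (hinit : DPORewriting.HasStrictMInitial M)
    (hunion : DPORewriting.HasMEffectiveUnions M)
    (hfin : DPORewriting.IsMFinitary M)
    (R₁ R₂ R₃ : DPORewriting.RuleAC M) :
    ∃ φ : (Σ μ₂₁ : DPORewriting.Match R₂ R₁, DPORewriting.Match R₃ (DPORewriting.comp R₂ R₁ μ₂₁)) ≃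
        (Σ μ₃₂ : DPORewriting.Match R₃ R₂, DPORewriting.Match (DPORewriting.comp R₃ R₂ μ₃₂) R₁),
      ∀ x, ∃ e : DPORewriting.LinearRule.Iso
          (DPORewriting.comp R₃ (DPORewriting.comp R₂ R₁ x.1) x.2).rule
          (DPORewriting.comp (DPORewriting.comp R₃ R₂ (φ x).1) R₁ (φ x).2).rule,
        DPORewriting.DotEquivAlong e := by
  obtain ⟨φ, hφ⟩ := DPORewriting.exists_equiv_of_existsUnique _
    (DPORewriting.Chain.existsUnique_right (R₁ := R₁) (R₂ := R₂) (R₃ := R₃) hunion hfin)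
    (DPORewriting.Chain.existsUnique_left hunion hfin)
  refine ⟨φ, fun x => ?_⟩
  obtain ⟨F, hl, hr⟩ := hφ x
  obtain ⟨e, he⟩ := hl.exists_iso hunion hfin
  obtain ⟨e', he'⟩ := hr.exists_iso hunion hfin
  refine ⟨e.trans e'.symm, fun X m hm => ?_⟩
  have hι : (e.trans e'.symm).ι.inv = e'.ι.hom ≫ e.ι.inv := rfl
  have hM : M ((e.trans e'.symm).ι.inv ≫ m) := DPORewriting.MAdhesive.comp_mem _ _
    (DPORewriting.MAdhesive.mem_of_isIso _ (e.trans e'.symm).ι.isIso_inv) hm.1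
  rw [he X m hm.1, he' X _ hM, hι, Category.assoc, Iso.inv_hom_id_assoc]
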